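/- Let $\Gamma$ be a subgroup of $\mathrm{SL}(2,\mathbb C)$ and let $R$ be a commutative $\mathbb C$-algebra of functions in one variable $z$ which is a domain, such that $\Gamma$ acts on $R$ by $(f\cdot\gamma)(z)=f\left(\frac{az+b}{cz+d}\right)$ for $\gamma=\left(\begin{smallmatrix}a&b\\c&d\end{smallmatrix}\right)\in\Gamma$, the function $z\mapsto cz+d$ is an invertible element of $R$ for every $\gamma\in\Gamma$, and $R$ is stable under $\partial_z$. Put $f^{(n)}=\partial_z^n f$, $(f|_m\gamma)(z)=(cz+d)^{-m}f\left(\frac{az+b}{cz+d}\right)$ and $\delta=-\frac12\partial_z$. Let $C_0=R[[y;\delta]]_2$ be the ring of power series $\sum_{n\ge0}f_ny^n$ ($f_n\in R$) with multiplication determined by $$y^{i}f=\sum_{k\ge0}\Big(\prod_{j=1}^{k}\tfrac{2(j-1)+i}{j}\Big)\delta^k(f)\,y^{i+2k}\qquad(f\in R,\ i\ge0).$$ For $\gamma\in\Gamma$ let $y\cdot\gamma$ be the unique $p\in C_0$ of the form $p=(cz+d)^{-1}y+\cdots$ such that $p^2=y^2(cz+d)^{-2}$ (product in $C_0$), and let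 $\Gamma$ act on $C_0$ by $\big(\sum_n f_ny^n\big)\cdot\gamma=\sum_n(f_n\cdot\gamma)(y\cdot\gamma)^n$. For $m\ge0$ consider the following conditions on a linear map $\psi:R\to C_0$: - (C1) $\psi(f|_m\gamma)=\psi(f)\cdot\gamma$ for all $f\in R$, $\gamma\in\Gamma$; - (C2) there is a complex sequence $(\alpha(n))_{n\ge0}$ with $\psi(f)=\sum_{n\ge0}\alpha(n)f^{(n)}y^{m+2n}$ for all $f\in R$; - (C3) $\alpha(0)=1$. (a) For every $m\ge1$, the linear map $\psi_m:R\to C_0$, $$\psi_m(f)=\sum_{n\ge0}\alpha_m(n)f^{(n)}y^{m+2n},\qquad \alpha_m(n)=\frac{(-1)^n}{4^nn!}\prod_{i=0}^{n-1}\frac{(m+2i)(m+2i+2)}{m+i},$$ satisfies (C1), (C2) and (C3). If $\Gamma$ contains a matrix with $c\ne0$, then $\psi_m$ is the only linear map satisfying (C1), (C2) and (C3), and $(\alpha_m(n))_{n\ge 0}$ is the only sequence $(\alpha(n))_{n\ge 0}$ with $\alpha(0)=1$ such that $f\mapsto\sum_{n\ge0}\alpha(n)f^{(n)}y^{m+2n}$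 satisfies (C1). (b) For all $n\ge0$, $$\alpha_{2k}(n)=\frac{(2k-1)!\,(n+k-1)!}{(n+2k-1)!\,(k-1)!}\binom{-k-1}{n}\quad(k\ge1),$$ $$\alpha_{2k+1}(n)=\frac{k!^2}{(2k+1)!}\,\frac{(-1)^n}{16^n}\,\frac{(2k+1+2n)!\,(2k+2n)!}{n!\,(2k+n)!\,(k+n)!^2}\quad(k\ge0).$$ (c) For $m=0$ and every $c_0\in\mathbb C$ the map $f\mapsto f+c_0\sum_{n\ge1}(-1)^nf^{(n)}y^{2n}$ satisfies (C1), (C2) and (C3); if $\Gamma$ contains a matrix with $c\neq0$, every linear map satisfying (C1), (C2) and (C3) is of this form. -/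

import Mathlib

noncomputable section

/-! ### The ring `R[[y ; δ]]₂` -/

/-- The coefficient `∏_{j=1}^{k} (2 (j - 1) + i) / j` of `δ^k(f) y^(i + 2 k)` in `y^i f`. -/
def quadCoeff (i k : ℕ) : ℂ := ∏ j ∈ Finset.range k, ((i : ℂ) + 2 * j) / ((j : ℂ) + 1)

/-- The power series `∑ fₙ yⁿ` with coefficients in `R` on the left, identified with the sequence
`(fₙ)`; they form the ring `R[[y ; δ]]₂` for the multiplication defined below. -/
def QuadSeries {R : Type*} [CommRing R] [Algebra ℂ R] (_δ : Derivation ℂ R R) : Type _ := ℕ → R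

namespace QuadSeries

open Finset

variable {R : Type*} [CommRing R] [Algebra ℂ R] {δ : Derivation ℂ R R}

instance : AddCommGroup (QuadSeries δ) := inferInstanceAs (AddCommGroup (ℕ → R))
instance : Module ℂ (QuadSeries δ) := inferInstanceAs (Module ℂ (ℕ → R))

/-- The coefficient of `yⁿ`. -/
def coeff (n : ℕ) (q : QuadSeries δ) : R := q n

/-- The series `∑ aₙ yⁿ`. -/
def mk (a : ℕ → R) : QuadSeries δ := a

theorem ext' {p q : QuadSeries δ} (h : ∀ n, coeff n p = coeff n q) : p = q := funext h

theorem coeff_mk (a : ℕ → R) (n : ℕ) : coeff n (mk a : QuadSeries δ) = a n := rfl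
theorem coeff_add (n : ℕ) (p q : QuadSeries δ) : coeff n (p + q) = coeff n p + coeff n q := rfl
theorem coeff_zero (n : ℕ) : coeff n (0 : QuadSeries δ) = 0 := rfl

/-- The monomial `f yⁿ`. -/
def single (n : ℕ) (f : R) : QuadSeries δ := mk fun i => if i = n then f else 0

instance : One (QuadSeries δ) := ⟨single 0 1⟩

/-- `(∑ fᵢ yⁱ) (∑ gⱼ yʲ) = ∑_{i,j} fᵢ (yⁱ gⱼ) yʲ` with
`yⁱ g = ∑ₖ quadCoeff i k • δ^k(g) y^(i + 2 k)`. -/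
instance : Mul (QuadSeries δ) :=
  ⟨fun p q => mk fun n =>
    ∑ t ∈ range (n + 1) ×ˢ range (n + 1) ×ˢ range (n + 1) with t.1 + 2 * t.2.1 + t.2.2 = n,
      quadCoeff t.1 t.2.1 • (coeff t.1 p * (δ^[t.2.1]) (coeff t.2.2 q))⟩

theorem coeff_mul_box {N n : ℕ} (hN : n < N) (p q : QuadSeries δ) :
    coeff n (p * q) = ∑ i ∈ range N, ∑ k ∈ range N, ∑ j ∈ range N,
      if i + 2 * k + j = n then quadCoeff i k • (coeff i p * (δ^[k]) (coeff j q)) else 0 := by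
  have h : coeff n (p * q) =
    ∑ t ∈ range (n + 1) ×ˢ range (n + 1) ×ˢ range (n + 1) with t.1 + 2 * t.2.1 + t.2.2 = n,
      quadCoeff t.1 t.2.1 • (coeff t.1 p * (δ^[t.2.1]) (coeff t.2.2 q)) := rfl
  rw [h]
  simp_rw [← Finset.sum_product']
  rw [← Finset.sum_filter]
  refine Finset.sum_congr ?_ fun _ _ => rfl
  ext ⟨i, k, j⟩
  simp only [mem_filter, mem_product, mem_range]
  constructor <;> rintro ⟨_, h⟩ <;> refine ⟨?_, h⟩ <;> omega

theorem quadCoeff_succ (i k : ℕ) :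
    ((k : ℂ) + 1) * quadCoeff i (k + 1) = ((i : ℂ) + 2 * k) * quadCoeff i k := by
  have : (k : ℂ) + 1 ≠ 0 := by exact_mod_cast Nat.succ_ne_zero k
  rw [quadCoeff, prod_range_succ, ← quadCoeff]; field_simp

theorem quadCoeff_zero_right (i : ℕ) : quadCoeff i 0 = 1 := by simp [quadCoeff]

theorem quadCoeff_zero_left (k : ℕ) : quadCoeff 0 (k + 1) = 0 := by
  simp [quadCoeff, prod_range_succ']

theorem quadCoeff_split (i t v : ℕ) :
    quadCoeff i (t + v) * (((t + v).choose t : ℕ) : ℂ) = quadCoeff i t * quadCoeff (i + 2 * t) v := by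
  induction v with
  | zero => simp [quadCoeff_zero_right]
  | succ v ih =>
    have h1 : ((t + v : ℕ) : ℂ) + 1 ≠ 0 := by exact_mod_cast Nat.succ_ne_zero (t + v)
    have h2 : (v : ℂ) + 1 ≠ 0 := by exact_mod_cast Nat.succ_ne_zero v
    have e1 := quadCoeff_succ i (t + v)
    have e2 := quadCoeff_succ (i + 2 * t) v
    have e3 : (((t + v + 1).choose t : ℕ) : ℂ) * ((v : ℂ) + 1)
        = ((t : ℂ) + v + 1) * (((t + v).choose t : ℕ) : ℂ) := by
      have := Nat.add_one_mul_choose_eq (t + v) v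
      have a1 : (t + v + 1).choose t = (t + v + 1).choose (v + 1) :=
        Nat.choose_symm_of_eq_add (by omega)
      have a2 : (t + v).choose t = (t + v).choose v := Nat.choose_symm_of_eq_add (by omega)
      rw [a1, a2]; exact_mod_cast this.symm
    push_cast at h1 e1 e2
    apply mul_left_cancel₀ h1
    apply mul_left_cancel₀ h2
    rw [← add_assoc]
    linear_combination ((v : ℂ) + 1) * (((t + v + 1).choose t : ℕ) : ℂ) * e1
      + ((i : ℂ) + 2 * (t + v)) * quadCoeff i (t + v) * e3
      + ((i : ℂ) + 2 * (t + v)) * (t + v + 1) * ih - ((t : ℂ) + v + 1) * quadCoeff i t * e2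

theorem quadCoeff_add (a b N : ℕ) :
    quadCoeff (a + b) N = ∑ p ∈ antidiagonal N, quadCoeff a p.1 * quadCoeff b p.2 := by
  induction N with
  | zero => simp [quadCoeff_zero_right]
  | succ N ih =>
    have h1 : (N : ℂ) + 1 ≠ 0 := by exact_mod_cast Nat.succ_ne_zero N
    apply mul_left_cancel₀ h1
    rw [quadCoeff_succ, ih]
    have key : ((N : ℂ) + 1) * ∑ p ∈ antidiagonal (N + 1), quadCoeff a p.1 * quadCoeff b p.2
        = ∑ p ∈ antidiagonal (N + 1), ((p.1 : ℂ) * quadCoeff a p.1) * quadCoeff b p.2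
          + ∑ p ∈ antidiagonal (N + 1), quadCoeff a p.1 * ((p.2 : ℂ) * quadCoeff b p.2) := by
      rw [mul_sum, ← sum_add_distrib]
      refine sum_congr rfl fun p hp => ?_
      have : (p.1 : ℂ) + p.2 = N + 1 := by exact_mod_cast (HasAntidiagonal.mem_antidiagonal.mp hp)
      rw [← this]; ring
    rw [key, Finset.Nat.sum_antidiagonal_succ, Finset.Nat.sum_antidiagonal_succ', mul_sum]
    simp only [Nat.cast_zero, zero_mul, mul_zero, zero_add]
    rw [← sum_add_distrib]
    refine sum_congr rfl fun p hp => ?_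
    have : (p.1 : ℂ) + p.2 = N := by exact_mod_cast (HasAntidiagonal.mem_antidiagonal.mp hp)
    push_cast
    rw [quadCoeff_succ, quadCoeff_succ, ← this]; ring

theorem iterate_map_sum (δ : Derivation ℂ R R) (n : ℕ) {ι : Type*} (s : Finset ι) (a : ι → R) :
    (δ^[n]) (∑ x ∈ s, a x) = ∑ x ∈ s, (δ^[n]) (a x) := by
  induction n with
  | zero => simp
  | succ n ih => simp only [Function.iterate_succ_apply', ih, map_sum]

theorem iterate_map_smul (δ : Derivation ℂ R R) (n : ℕ) (c : ℂ) (a : R) :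
    (δ^[n]) (c • a) = c • (δ^[n]) a := by
  induction n with
  | zero => simp
  | succ n ih => rw [Function.iterate_succ_apply', Function.iterate_succ_apply', ih, Derivation.map_smul]

theorem iterate_map_add (δ : Derivation ℂ R R) (n : ℕ) (a b : R) :
    (δ^[n]) (a + b) = (δ^[n]) a + (δ^[n]) b := by
  induction n with
  | zero => simp
  | succ n ih => simp only [Function.iterate_succ_apply', ih, map_add]

theorem iterate_map_zero (δ : Derivation ℂ R R) (n : ℕ) : (δ^[n]) (0 : R) = 0 := by
  induction n with
  | zero => simp
  | succ n ih => simp only [Function.iterate_succ_apply', ih, map_zero]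

theorem iterate_leibniz (δ : Derivation ℂ R R) (n : ℕ) (a b : R) :
    (δ^[n]) (a * b) = ∑ p ∈ antidiagonal n,
      ((n.choose p.1 : ℕ) : ℂ) • ((δ^[p.1]) a * (δ^[p.2]) b) := by
  induction n with
  | zero => simp
  | succ n ih =>
    simp only [Nat.cast_smul_eq_nsmul] at ih ⊢
    rw [sum_antidiagonal_choose_succ_nsmul (fun i j => (δ^[i]) a * (δ^[j]) b) n]
    simp only [Function.iterate_succ_apply', ih, map_sum, map_nsmul, Derivation.leibniz,
      smul_eq_mul, smul_add, sum_add_distrib, add_right_inj]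
    refine sum_congr rfl fun ⟨i, j⟩ hij => ?_
    rw [n.choose_symm_of_eq_add (HasAntidiagonal.mem_antidiagonal.1 hij).symm, mul_comm]

theorem quad_compose (δ : Derivation ℂ R R) (i j M : ℕ) (g h : R) :
    ∑ p ∈ antidiagonal M, (quadCoeff i p.1 * quadCoeff j p.2) • (δ^[p.1]) (g * (δ^[p.2]) h)
      = ∑ p ∈ antidiagonal M, (quadCoeff i p.1 * quadCoeff (i + 2 * p.1 + j) p.2) •
          ((δ^[p.1]) g * (δ^[p.2]) h) := by
  have e : ∀ t r, quadCoeff (i + 2 * t + j) r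
      = ∑ p ∈ antidiagonal r, quadCoeff (i + 2 * t) p.1 * quadCoeff j p.2 :=
    fun t r => quadCoeff_add _ _ _
  simp only [e, iterate_leibniz, smul_sum, mul_sum, sum_smul, smul_smul,
    ← Function.iterate_add_apply]
  rw [sum_sigma', sum_sigma']
  refine sum_nbij' (fun x => ⟨(x.2.1, x.2.2 + x.1.2), (x.2.2, x.1.2)⟩)
    (fun x => ⟨(x.1.1 + x.2.1, x.2.2), (x.1.1, x.2.1)⟩) ?_ ?_ ?_ ?_ ?_
  · rintro ⟨⟨k, u⟩, ⟨t, v⟩⟩ hx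
    simp only [mem_sigma, HasAntidiagonal.mem_antidiagonal, and_true] at hx ⊢; omega
  · rintro ⟨⟨k, u⟩, ⟨t, v⟩⟩ hx
    simp only [mem_sigma, HasAntidiagonal.mem_antidiagonal, and_true] at hx ⊢; omega
  · rintro ⟨⟨k, u⟩, ⟨t, v⟩⟩ hx
    simp only [mem_sigma, HasAntidiagonal.mem_antidiagonal] at hx ⊢
    obtain ⟨h1, rfl⟩ := hx; rfl
  · rintro ⟨⟨k, u⟩, ⟨t, v⟩⟩ hx
    simp only [mem_sigma, HasAntidiagonal.mem_antidiagonal] at hx ⊢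
    obtain ⟨h1, rfl⟩ := hx; rfl
  · rintro ⟨⟨k, u⟩, ⟨t, v⟩⟩ hx
    simp only [mem_sigma, HasAntidiagonal.mem_antidiagonal] at hx ⊢
    obtain ⟨h1, rfl⟩ := hx
    congr 1
    linear_combination quadCoeff j u * quadCoeff_split i t v

theorem sum_box_eq_antidiagonal {A : Type*} [AddCommMonoid A] {N n S : ℕ} (hN : n < N)
    (F : ℕ → ℕ → A) :
    ∑ t ∈ range N, ∑ k ∈ range N, (if S + 2 * (t + k) = n then F t k else 0)
      = ∑ M ∈ range N, if S + 2 * M = n then ∑ p ∈ antidiagonal M, F p.1 p.2 else 0 := by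
  rw [← sum_product', ← sum_filter, ← sum_filter, sum_sigma']
  refine sum_nbij' (fun x => ⟨x.1 + x.2, x⟩) (fun x => x.2) ?_ ?_ ?_ ?_ ?_
  · rintro ⟨t, k⟩ hx
    simp only [mem_filter, mem_product, mem_range, mem_sigma, HasAntidiagonal.mem_antidiagonal, and_true]
      at hx ⊢
    omega
  · rintro ⟨M, t, k⟩ hx
    simp only [mem_filter, mem_product, mem_range, mem_sigma,
      HasAntidiagonal.mem_antidiagonal] at hx ⊢
    omega
  · rintro ⟨t, k⟩ hx; rfl
  · rintro ⟨M, t, k⟩ hx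
    simp only [mem_sigma, HasAntidiagonal.mem_antidiagonal] at hx ⊢
    obtain ⟨h1, rfl⟩ := hx; rfl
  · rintro ⟨t, k⟩ hx; rfl

theorem sum_perm_left {A : Type*} [AddCommMonoid A] (s : Finset ℕ)
    (F : ℕ → ℕ → ℕ → ℕ → ℕ → ℕ → A) :
    ∑ a ∈ s, ∑ k ∈ s, ∑ l ∈ s, ∑ i ∈ s, ∑ t ∈ s, ∑ j ∈ s, F a k l i t j
      = ∑ i ∈ s, ∑ j ∈ s, ∑ l ∈ s, ∑ t ∈ s, ∑ k ∈ s, ∑ a ∈ s, F a k l i t j := by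
  simp only [← sum_product']
  refine sum_nbij' (fun x => (x.2.2.2.1, x.2.2.2.2.2, x.2.2.1, x.2.2.2.2.1, x.2.1, x.1))
    (fun x => (x.2.2.2.2.2, x.2.2.2.2.1, x.2.2.1, x.1, x.2.2.2.1, x.2.1)) ?_ ?_ ?_ ?_ ?_
  · rintro ⟨a, k, l, i, t, j⟩ hx; simp only [mem_product] at hx ⊢; tauto
  · rintro ⟨a, k, l, i, t, j⟩ hx; simp only [mem_product] at hx ⊢; tauto
  · intro x _; rfl
  · intro x _; rfl
  · intro x _; rfl

theorem sum_perm_right {A : Type*} [AddCommMonoid A] (s : Finset ℕ)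
    (F : ℕ → ℕ → ℕ → ℕ → ℕ → ℕ → A) :
    ∑ i ∈ s, ∑ k ∈ s, ∑ b ∈ s, ∑ j ∈ s, ∑ u ∈ s, ∑ l ∈ s, F i k b j u l
      = ∑ i ∈ s, ∑ j ∈ s, ∑ l ∈ s, ∑ k ∈ s, ∑ u ∈ s, ∑ b ∈ s, F i k b j u l := by
  simp only [← sum_product']
  refine sum_nbij' (fun x => (x.1, x.2.2.2.1, x.2.2.2.2.2, x.2.1, x.2.2.2.2.1, x.2.2.1))
    (fun x => (x.1, x.2.2.2.1, x.2.2.2.2.2, x.2.1, x.2.2.2.2.1, x.2.2.1)) ?_ ?_ ?_ ?_ ?_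
  · rintro ⟨a, k, l, i, t, j⟩ hx; simp only [mem_product] at hx ⊢; tauto
  · rintro ⟨a, k, l, i, t, j⟩ hx; simp only [mem_product] at hx ⊢; tauto
  · intro x _; rfl
  · intro x _; rfl
  · intro x _; rfl

theorem sum_ite_ite {A : Type*} [AddCommMonoid A] {N n X S : ℕ} (hN : n < N) (hX : S = n → X ≤ n)
    (G : A) :
    ∑ a ∈ range N, (if X = a then (if S = n then G else 0) else 0) = if S = n then G else 0 := by
  rw [sum_ite_eq]
  split_ifs with h1 h2 h2
  · rfl
  · rfl
  · exact absurd (mem_range.mpr (lt_of_le_of_lt (hX h2) hN)) h1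
  · rfl

theorem mul_assoc' (p q r : QuadSeries δ) : p * q * r = p * (q * r) := by
  apply ext'
  intro n
  have hN : n < n + 1 := Nat.lt_succ_self n
  set N := n + 1 with hNdef
  have L : coeff n (p * q * r) = ∑ i ∈ range N, ∑ j ∈ range N, ∑ l ∈ range N,
      ∑ t ∈ range N, ∑ k ∈ range N, if (i + j + l) + 2 * (t + k) = n then
        coeff i p * ((quadCoeff i t * quadCoeff (i + 2 * t + j) k) •
          ((δ^[t]) (coeff j q) * (δ^[k]) (coeff l r))) else 0 := by
    rw [coeff_mul_box hN]
    have e : ∀ a ∈ range N, ∀ k l, (if a + 2 * k + l = n then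
        quadCoeff a k • (coeff a (p * q) * (δ^[k]) (coeff l r)) else 0)
        = ∑ i ∈ range N, ∑ t ∈ range N, ∑ j ∈ range N, if i + 2 * t + j = a then
          (if (i + j + l) + 2 * (t + k) = n then
        coeff i p * ((quadCoeff i t * quadCoeff (i + 2 * t + j) k) •
          ((δ^[t]) (coeff j q) * (δ^[k]) (coeff l r))) else 0) else 0 := by
      intro a ha k l
      rw [coeff_mul_box (mem_range.mp ha)]
      split_ifs with h
      · rw [sum_mul, smul_sum]; refine sum_congr rfl fun i _ => ?_
        rw [sum_mul, smul_sum]; refine sum_congr rfl fun t _ => ?_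
        rw [sum_mul, smul_sum]; refine sum_congr rfl fun j _ => ?_
        by_cases h2 : i + 2 * t + j = a
        · rw [if_pos h2, if_pos h2, if_pos (by omega), h2]
          simp only [smul_mul_assoc, mul_smul_comm, smul_smul, mul_assoc]
          congr 1; ring
        · rw [if_neg h2, if_neg h2]; simp
      · symm
        refine sum_eq_zero fun i _ => sum_eq_zero fun t _ => sum_eq_zero fun j _ => ?_
        by_cases h2 : i + 2 * t + j = a
        · rw [if_pos h2, if_neg (by omega)]
        · rw [if_neg h2]
    rw [sum_congr rfl fun a ha => sum_congr rfl fun k _ => sum_congr rfl fun l _ => e a ha k l]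
    rw [sum_perm_left]
    refine sum_congr rfl fun i _ => sum_congr rfl fun j _ => sum_congr rfl fun l _ =>
      sum_congr rfl fun t _ => sum_congr rfl fun k _ => ?_
    exact sum_ite_ite hN (fun h => by omega) _
  have R' : coeff n (p * (q * r)) = ∑ i ∈ range N, ∑ j ∈ range N, ∑ l ∈ range N,
      ∑ t ∈ range N, ∑ k ∈ range N, if (i + j + l) + 2 * (t + k) = n then
        coeff i p * ((quadCoeff i t * quadCoeff j k) •
          ((δ^[t]) (coeff j q * (δ^[k]) (coeff l r)))) else 0 := by
    rw [coeff_mul_box hN]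
    have e : ∀ b ∈ range N, ∀ i k, (if i + 2 * k + b = n then
        quadCoeff i k • (coeff i p * (δ^[k]) (coeff b (q * r))) else 0)
        = ∑ j ∈ range N, ∑ u ∈ range N, ∑ l ∈ range N, if j + 2 * u + l = b then
          (if (i + j + l) + 2 * (k + u) = n then
        coeff i p * ((quadCoeff i k * quadCoeff j u) •
          ((δ^[k]) (coeff j q * (δ^[u]) (coeff l r)))) else 0) else 0 := by
      intro b hb i k
      rw [coeff_mul_box (mem_range.mp hb)]
      split_ifs with h
      · rw [iterate_map_sum, mul_sum, smul_sum]; refine sum_congr rfl fun j _ => ?_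
        rw [iterate_map_sum, mul_sum, smul_sum]; refine sum_congr rfl fun u _ => ?_
        rw [iterate_map_sum, mul_sum, smul_sum]; refine sum_congr rfl fun l _ => ?_
        by_cases h2 : j + 2 * u + l = b
        · rw [if_pos h2, if_pos h2, if_pos (by omega)]
          simp only [iterate_map_smul, mul_smul_comm, smul_smul]
        · rw [if_neg h2, if_neg h2]; simp
      · symm
        refine sum_eq_zero fun j _ => sum_eq_zero fun u _ => sum_eq_zero fun l _ => ?_
        by_cases h2 : j + 2 * u + l = b
        · rw [if_pos h2, if_neg (by omega)]
        · rw [if_neg h2]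
    rw [sum_congr rfl fun i _ => sum_congr rfl fun k _ => sum_congr rfl fun b hb => e b hb i k]
    rw [sum_perm_right]
    refine sum_congr rfl fun i _ => sum_congr rfl fun j _ => sum_congr rfl fun l _ =>
      sum_congr rfl fun k _ => sum_congr rfl fun u _ => ?_
    exact sum_ite_ite hN (fun h => by omega) _
  rw [L, R']
  refine sum_congr rfl fun i _ => sum_congr rfl fun j _ => sum_congr rfl fun l _ => ?_
  rw [sum_box_eq_antidiagonal hN (fun t k => coeff i p *
      ((quadCoeff i t * quadCoeff (i + 2 * t + j) k) •
          ((δ^[t]) (coeff j q) * (δ^[k]) (coeff l r)))),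
    sum_box_eq_antidiagonal hN (fun t k => coeff i p * ((quadCoeff i t * quadCoeff j k) •
          ((δ^[t]) (coeff j q * (δ^[k]) (coeff l r)))))]
  simp only [← mul_sum, quad_compose]

theorem coeff_zero_one : coeff 0 (1 : QuadSeries δ) = 1 := by
  change (if (0 : ℕ) = 0 then (1 : R) else 0) = 1
  exact if_pos rfl

theorem one_mul' (p : QuadSeries δ) : 1 * p = p := by
  apply ext'; intro n
  rw [coeff_mul_box (Nat.lt_succ_self n), sum_eq_single 0, sum_eq_single 0, sum_eq_single n]
  · simp [quadCoeff_zero_right, coeff_zero_one]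
  · intro j _ hj; rw [if_neg (by omega)]
  · simp
  · intro k _ hk
    refine sum_eq_zero fun j _ => ?_
    obtain ⟨k, rfl⟩ := Nat.exists_eq_succ_of_ne_zero hk
    rw [quadCoeff_zero_left]; simp
  · simp
  · intro i _ hi
    refine sum_eq_zero fun k _ => sum_eq_zero fun j _ => ?_
    rw [show coeff i (1 : QuadSeries δ) = 0 from if_neg hi]; simp
  · simp

theorem iterate_map_one (δ : Derivation ℂ R R) (k : ℕ) : (δ^[k + 1]) (1 : R) = 0 := by
  rw [Function.iterate_succ_apply, Derivation.map_one_eq_zero, iterate_map_zero]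

theorem mul_one' (p : QuadSeries δ) : p * 1 = p := by
  apply ext'; intro n
  rw [coeff_mul_box (Nat.lt_succ_self n), sum_eq_single n, sum_eq_single 0, sum_eq_single 0]
  · simp [quadCoeff_zero_right, coeff_zero_one]
  · intro j _ hj; rw [if_neg (by omega)]
  · simp
  · intro k _ hk; refine sum_eq_zero fun j _ => ?_
    rw [if_neg (by omega)]
  · simp
  · intro i hi hin
    refine sum_eq_zero fun k _ => sum_eq_zero fun j _ => ?_
    by_cases hj : j = 0
    · subst hj
      rcases k with _ | k
      · rw [if_neg (by omega)]
      · rw [coeff_zero_one, iterate_map_one]; simp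
    · rw [show coeff j (1 : QuadSeries δ) = 0 from if_neg hj, iterate_map_zero]; simp
  · simp

instance : Ring (QuadSeries δ) :=
  { (inferInstance : AddCommGroup (QuadSeries δ)) with
    mul := (· * ·)
    one := 1
    mul_assoc := mul_assoc'
    one_mul := one_mul'
    mul_one := mul_one'
    zero_mul := fun p => ext' fun n => by
      rw [coeff_mul_box (Nat.lt_succ_self n)]; simp [coeff_zero]
    mul_zero := fun p => ext' fun n => by
      rw [coeff_mul_box (Nat.lt_succ_self n)]; simp [coeff_zero]
    left_distrib := fun p q r => ext' fun n => by
      simp only [coeff_add, coeff_mul_box (Nat.lt_succ_self n), ← sum_add_distrib,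
        iterate_map_add, mul_add, smul_add]
      refine sum_congr rfl fun i _ => sum_congr rfl fun k _ => sum_congr rfl fun j _ => ?_
      split_ifs <;> simp
    right_distrib := fun p q r => ext' fun n => by
      simp only [coeff_add, coeff_mul_box (Nat.lt_succ_self n), ← sum_add_distrib,
        add_mul, smul_add]
      refine sum_congr rfl fun i _ => sum_congr rfl fun k _ => sum_congr rfl fun j _ => ?_
      split_ifs <;> simp }

theorem coeff_single (m n : ℕ) (f : R) :
    coeff m (single n f : QuadSeries δ) = if m = n then f else 0 := rfl

theorem coeff_mul_low {p q : QuadSeries δ} {u v n : ℕ} (hp : ∀ i < u, coeff i p = 0)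
    (hq : ∀ j < v, coeff j q = 0) (hn : n < u + v) : coeff n (p * q) = 0 := by
  rw [coeff_mul_box (Nat.lt_succ_self n)]
  refine sum_eq_zero fun i _ => sum_eq_zero fun k _ => sum_eq_zero fun j _ => ?_
  split_ifs with h
  · by_cases hi : i < u
    · simp [hp i hi]
    · rw [hq j (by omega), iterate_map_zero]; simp
  · rfl

theorem coeff_mul_lead {p q : QuadSeries δ} {u v : ℕ} (hp : ∀ i < u, coeff i p = 0)
    (hq : ∀ j < v, coeff j q = 0) : coeff (u + v) (p * q) = coeff u p * coeff v q := by
  rw [coeff_mul_box (Nat.lt_succ_self (u + v)), sum_eq_single u, sum_eq_single 0,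
    sum_eq_single v]
  · simp [quadCoeff_zero_right]
  · intro j _ hj; rw [if_neg (by omega)]
  · intro h; exact absurd (mem_range.mpr (by omega)) h
  · intro k _ hk; refine sum_eq_zero fun j _ => ?_
    split_ifs with h
    · rw [hq j (by omega), iterate_map_zero]; simp
    · rfl
  · intro h; exact absurd (mem_range.mpr (by omega)) h
  · intro i _ hi
    refine sum_eq_zero fun k _ => sum_eq_zero fun j _ => ?_
    split_ifs with h
    · by_cases hiu : i < u
      · simp [hp i hiu]
      · rw [hq j (by omega), iterate_map_zero]; simp
    · rfl
  · intro h; exact absurd (mem_range.mpr (by omega)) h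

/-- The terms of degree less than `n`. -/
def trunc (n : ℕ) (p : QuadSeries δ) : QuadSeries δ := mk fun i => if i < n then coeff i p else 0

theorem coeff_sq_step {p : QuadSeries δ} (h0 : coeff 0 p = 0) {n : ℕ} (hn : 2 ≤ n) :
    coeff (n + 1) (p * p)
      = coeff (n + 1) (trunc n p * trunc n p) + (2 : ℂ) • (coeff 1 p * coeff n p) := by
  obtain ⟨r, hr⟩ : ∃ r, p = trunc n p + r := ⟨p - trunc n p, by abel⟩
  have hc : ∀ i, coeff i p = (if i < n then coeff i p else 0) + coeff i r := fun i => by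
    conv_lhs => rw [hr]
    rfl
  have r0 : ∀ i < n, coeff i r = 0 := fun i hi => by
    have := hc i; rw [if_pos hi] at this; simpa using this
  have rn : coeff n r = coeff n p := by
    have := hc n; rw [if_neg (lt_irrefl n)] at this; simpa using this.symm
  have t0 : ∀ i < 1, coeff i (trunc n p) = 0 := fun i hi => by
    obtain rfl : i = 0 := by omega
    show (if 0 < n then coeff 0 p else 0) = 0
    rw [h0]; simp
  have t1 : coeff 1 (trunc n p) = coeff 1 p := if_pos (by omega)
  have e : p * p = trunc n p * trunc n p + trunc n p * r + (r * trunc n p + r * r) := by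
    conv_lhs => rw [hr]
    noncomm_ring
  rw [e, coeff_add, coeff_add, coeff_add, coeff_mul_low r0 r0 (by omega), coeff_mul_lead r0 t0,
    add_comm n 1, coeff_mul_lead t0 r0, rn, t1, two_smul]
  ring

/-- The coefficients of the square root `e y + ⋯` of `q = e² y² + ⋯`, computed recursively. -/
def sqrtAux (e : Rˣ) (q : QuadSeries δ) : ℕ → R
  | n => if n = 0 then 0 else if n = 1 then (e : R) else
      (1 / 2 : ℂ) • ((↑e⁻¹ : R) * (coeff (n + 1) q - coeff (n + 1)
        ((mk fun i => if _h : i < n then sqrtAux e q i else 0 : QuadSeries δ) *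
          (mk fun i => if _h : i < n then sqrtAux e q i else 0 : QuadSeries δ))))
  termination_by n => n

/-- A series `e² y² + ⋯` with `e` invertible has exactly one square root of the form `e y + ⋯`. -/
theorem existsUnique_sqrt (e : Rˣ) (q : QuadSeries δ) (h0 : coeff 0 q = 0) (h1 : coeff 1 q = 0)
    (h2 : coeff 2 q = (e : R) ^ 2) :
    ∃! p : QuadSeries δ, coeff 0 p = 0 ∧ coeff 1 p = (e : R) ∧ p ^ 2 = q := by
  have low : ∀ p : QuadSeries δ, coeff 0 p = 0 → ∀ i < 1, coeff i p = 0 := fun p hp i hi => by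
    obtain rfl : i = 0 := by omega
    exact hp
  have hex : coeff 0 (mk (sqrtAux e q) : QuadSeries δ) = 0 ∧
      coeff 1 (mk (sqrtAux e q) : QuadSeries δ) = (e : R) ∧
      (mk (sqrtAux e q) : QuadSeries δ) ^ 2 = q := by
    refine ⟨?_, ?_, ?_⟩
    · rw [coeff_mk, sqrtAux]; simp
    · rw [coeff_mk, sqrtAux]; simp
    · have c0 : coeff 0 (mk (sqrtAux e q) : QuadSeries δ) = 0 := by rw [coeff_mk, sqrtAux]; simp
      have c1 : coeff 1 (mk (sqrtAux e q) : QuadSeries δ) = e := by rw [coeff_mk, sqrtAux]; simp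
      apply ext'
      intro n
      rw [pow_two]
      rcases n with _ | _ | _ | n
      · rw [coeff_mul_low (low _ c0) (low _ c0) (by omega), h0]
      · rw [coeff_mul_low (low _ c0) (low _ c0) (by omega), h1]
      · rw [show 0 + 1 + 1 = 1 + 1 from rfl, coeff_mul_lead (low _ c0) (low _ c0), c1, ← pow_two]
        exact h2.symm
      · rw [show n + 1 + 1 + 1 = (n + 2) + 1 from rfl, coeff_sq_step c0 (by omega), c1,
          coeff_mk _ (n + 2), sqrtAux, if_neg (by omega), if_neg (by omega)]
        rw [mul_smul_comm, smul_smul, Units.mul_inv_cancel_left]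
        norm_num [trunc, coeff_mk]
  refine ⟨mk (sqrtAux e q), hex, ?_⟩
  · rintro p ⟨p0, p1, hp⟩
    have key : ∀ p' : QuadSeries δ, coeff 0 p' = 0 → coeff 1 p' = e → p' ^ 2 = q →
        ∀ n, coeff n p = coeff n p' := by
      intro p' q0 q1 hq n
      induction n using Nat.strong_induction_on with
      | _ n ih =>
        rcases n with _ | _ | n
        · rw [p0, q0]
        · rw [p1, q1]
        · have ht : trunc (n + 2) p = trunc (n + 2) p' := by
            apply ext'; intro i
            show (if i < n + 2 then coeff i p else 0) = if i < n + 2 then coeff i p' else 0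
            split_ifs with hi
            · exact ih i hi
            · rfl
          have a := coeff_sq_step p0 (n := n + 2) (by omega)
          have b := coeff_sq_step q0 (n := n + 2) (by omega)
          rw [← pow_two, hp, ht, p1] at a
          rw [← pow_two, hq, q1, a] at b
          have b' := add_left_cancel b
          have b2 := congrArg (fun t => (1 / 2 : ℂ) • t) b'
          simp only [smul_smul] at b2
          norm_num at b2
          exact b2
    exact ext' (key _ hex.1 hex.2.1 hex.2.2)

end QuadSeries

/-! ### Functions of one variable `z` and the homographic action -/

namespace Homographic

open Finset Filter Topology TopologicalSpace

/-- `SL(2, ℂ)`. -/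
abbrev SL2C : Type := Matrix.SpecialLinearGroup (Fin 2) ℂ

/-- `c z + d` for `γ = (a b; c d)`. -/
def autFactor (γ : SL2C) (z : ℂ) : ℂ := γ.1 1 0 * z + γ.1 1 1

/-- `(a z + b) / (c z + d)` for `γ = (a b; c d)`. -/
def moebius (γ : SL2C) (z : ℂ) : ℂ := (γ.1 0 0 * z + γ.1 0 1) / autFactor γ z

/-- The filter of sets that contain a dense open subset of `U`. -/
def denseOpens (U : Opens ℂ) : Filter ℂ where
  sets := {S | ∃ V : Set ℂ, IsOpen V ∧ V ⊆ U ∧ V ⊆ S ∧ (U : Set ℂ) ⊆ closure V}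
  univ_sets := ⟨U, U.isOpen, subset_rfl, Set.subset_univ _, subset_closure⟩
  sets_of_superset := by
    rintro S T ⟨V, h1, h2, h3, h4⟩ hST
    exact ⟨V, h1, h2, h3.trans hST, h4⟩
  inter_sets := by
    rintro S T ⟨V, h1, h2, h3, h4⟩ ⟨W, k1, k2, k3, k4⟩
    refine ⟨V ∩ W, h1.inter k1, Set.inter_subset_left.trans h2,
      Set.inter_subset_inter h3 k3, fun x hx => ?_⟩
    rw [mem_closure_iff]
    intro O hO hxO
    obtain ⟨y, hyO, hyV⟩ := mem_closure_iff.mp (h4 hx) O hO hxO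
    obtain ⟨t, ⟨htO, htV⟩, htW⟩ := mem_closure_iff.mp (k4 (h2 hyV)) (O ∩ V) (hO.inter h1) ⟨hyO, hyV⟩
    exact ⟨t, htO, htV, htW⟩

/-- Functions defined on (a dense open subset of) `U`: two functions are identified when they
agree on a dense open subset of `U`. For holomorphic or meromorphic functions on `U` this is plain
equality, poles being ignored. -/
def FunGerm (U : Opens ℂ) : Type := Germ (denseOpens U) ℂ

namespace FunGerm

variable {U : Opens ℂ}

instance : CommRing (FunGerm U) := inferInstanceAs (CommRing (Germ (denseOpens U) ℂ))

/-- The class of a function. -/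
def of (U : Opens ℂ) (f : ℂ → ℂ) : FunGerm U := (f : Germ (denseOpens U) ℂ)

/-- The constant functions make `FunGerm U` a `ℂ`-algebra. -/
instance : Algebra ℂ (FunGerm U) :=
  RingHom.toAlgebra
    { toFun := fun c => of U (fun _ => c)
      map_one' := rfl
      map_mul' := fun _ _ => rfl
      map_zero' := rfl
      map_add' := fun _ _ => rfl }

theorem of_add (f g : ℂ → ℂ) : of U f + of U g = of U (f + g) := rfl
theorem of_mul (f g : ℂ → ℂ) : of U f * of U g = of U (f * g) := rfl
theorem smul_of (c : ℂ) (f : ℂ → ℂ) : c • of U f = of U (fun z => c * f z) := rfl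

theorem of_eq_of {f g : ℂ → ℂ} (h : ∀ᶠ z in denseOpens U, f z = g z) : of U f = of U g :=
  Germ.coe_eq.mpr h

/-- The derivative `∂_z`. -/
def deriv : FunGerm U → FunGerm U :=
  Quotient.map' (fun f => _root_.deriv f) (by
    rintro f g ⟨V, h1, h2, h3, h4⟩
    refine ⟨V, h1, h2, fun z hz => ?_, h4⟩
    exact Filter.EventuallyEq.deriv_eq (Filter.mem_of_superset (h1.mem_nhds hz) h3))

theorem deriv_of (f : ℂ → ℂ) : deriv (of U f) = of U (_root_.deriv f) := rfl

/-- `f` is (the class of) a function that is holomorphic on a dense open subset of `U`. -/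
def IsHolomorphic (f : FunGerm U) : Prop :=
  ∃ g : ℂ → ℂ, of U g = f ∧ ∀ᶠ z in denseOpens U, DifferentiableAt ℂ g z

end FunGerm

theorem tendsto_moebius {U : Opens ℂ} (γ : SL2C)
    (hγ : ∀ z ∈ U, autFactor γ z ≠ 0 → moebius γ z ∈ U) :
    Tendsto (moebius γ) (denseOpens U) (denseOpens U) := by
  have hdet : γ.1 0 0 * γ.1 1 1 - γ.1 0 1 * γ.1 1 0 = 1 := by
    rw [← Matrix.det_fin_two]; exact γ.2
  have hcont : Continuous (autFactor γ) := by unfold autFactor; fun_prop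
  have hDopen : IsOpen {z | autFactor γ z ≠ 0} := isOpen_ne_fun hcont continuous_const
  have hDdense : Dense {z | autFactor γ z ≠ 0} := by
    by_cases hc : γ.1 1 0 = 0
    · have hd : γ.1 1 1 ≠ 0 := by rintro hd; rw [hc, hd] at hdet; simp at hdet
      have : {z | autFactor γ z ≠ 0} = Set.univ := by
        ext z; simp [autFactor, hc, hd]
      rw [this]; exact dense_univ
    · refine (dense_compl_singleton (-(γ.1 1 1) / γ.1 1 0)).mono fun z hz => ?_
      intro h
      apply hz
      have h' : γ.1 1 0 * z + γ.1 1 1 = 0 := h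
      rw [Set.mem_singleton_iff, eq_div_iff hc]
      linear_combination h'
  have hder : ∀ z, autFactor γ z ≠ 0 → HasStrictDerivAt (moebius γ) (1 / autFactor γ z ^ 2) z := by
    intro z hz
    have h1 : HasStrictDerivAt (fun z => γ.1 0 0 * z + γ.1 0 1) (γ.1 0 0) z := by
      simpa using ((hasStrictDerivAt_id z).const_mul (γ.1 0 0)).add_const (γ.1 0 1)
    have h2' : HasStrictDerivAt (fun z => γ.1 1 0 * z + γ.1 1 1) (γ.1 1 0) z := by
      simpa using ((hasStrictDerivAt_id z).const_mul (γ.1 1 0)).add_const (γ.1 1 1)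
    have h2 : HasStrictDerivAt (autFactor γ) (γ.1 1 0) z := h2'
    have h3 := h1.div h2 hz
    have e : (γ.1 0 0 * autFactor γ z - (γ.1 0 0 * z + γ.1 0 1) * γ.1 1 0) = 1 := by
      unfold autFactor; linear_combination hdet
    rw [e] at h3
    exact h3
  rintro S ⟨V, h1, h2, h3, h4⟩
  refine ⟨U ∩ ({z | autFactor γ z ≠ 0} ∩ moebius γ ⁻¹' V), ?_, Set.inter_subset_left,
    fun z hz => h3 hz.2.2, ?_⟩
  · refine U.isOpen.inter (ContinuousOn.isOpen_inter_preimage ?_ hDopen h1)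
    exact fun z hz => (hder z hz).hasDerivAt.continuousAt.continuousWithinAt
  · intro x hx
    rw [mem_closure_iff]
    intro O hO hxO
    obtain ⟨w, ⟨hwO, hwU⟩, hwD⟩ := hDdense.inter_open_nonempty (O ∩ U) (hO.inter U.isOpen) ⟨x, hxO, hx⟩
    have hmap := (hder w hwD).map_nhds_eq (by simpa using hwD)
    have hfr : ∃ᶠ v in 𝓝 (moebius γ w), v ∈ V := mem_closure_iff_frequently.mp (h4 (hγ w hwU hwD))
    rw [← hmap, frequently_map] at hfr
    obtain ⟨t, ht1, ht2⟩ := (hfr.and_eventually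
      ((((hO.inter U.isOpen).inter hDopen).mem_nhds ⟨⟨hwO, hwU⟩, hwD⟩))).exists
    exact ⟨t, ht2.1.1, ht2.1.2, ht2.2, ht1⟩

/-- A commutative `ℂ`-algebra `R` of functions in one variable `z`, which is a domain, on which the
subgroup `Γ` of `SL(2, ℂ)` acts by `(f · γ)(z) = f ((a z + b) / (c z + d))`, whose units include
the functions `z ↦ c z + d`, and which is stable under `∂_z`. The functions live on an open set
`U` that is stable under `Γ` (up to the poles of the homographies). -/
structure FunctionAlgebra (Γ : Subgroup SL2C) where
  U : Opens ℂ
  moebius_mem : ∀ γ ∈ Γ, ∀ z ∈ U, autFactor γ z ≠ 0 → moebius γ z ∈ U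
  R : Subalgebra ℂ (FunGerm U)
  isDomain : IsDomain R
  isHolomorphic : ∀ f ∈ R, f.IsHolomorphic
  comp_mem : ∀ γ (hγ : γ ∈ Γ), ∀ f ∈ R,
    Germ.compTendsto f (moebius γ) (tendsto_moebius γ (moebius_mem γ hγ)) ∈ R
  isUnit_autFactor : ∀ γ ∈ Γ, ∃ u : Rˣ, ((u : R) : FunGerm U) = FunGerm.of U (autFactor γ)
  deriv_mem : ∀ f ∈ R, f.deriv ∈ R

namespace FunctionAlgebra

variable {Γ : Subgroup SL2C} (S : FunctionAlgebra Γ)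

/-- The derivation `∂_z` of `R`. -/
def partialZ : Derivation ℂ S.R S.R :=
  Derivation.mk'
    { toFun := fun f => ⟨(f : FunGerm S.U).deriv, S.deriv_mem f f.2⟩
      map_add' := by
        rintro ⟨f, hf⟩ ⟨g, hg⟩
        apply Subtype.ext
        obtain ⟨f, rfl, df⟩ := S.isHolomorphic f hf
        obtain ⟨g, rfl, dg⟩ := S.isHolomorphic g hg
        change FunGerm.of S.U (deriv (f + g)) = FunGerm.of S.U (deriv f + deriv g)
        refine FunGerm.of_eq_of ?_
        filter_upwards [df, dg] with z hf hg
        exact deriv_add hf hg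
      map_smul' := by
        rintro c ⟨f, hf⟩
        apply Subtype.ext
        obtain ⟨f, rfl, df⟩ := S.isHolomorphic f hf
        change FunGerm.of S.U (deriv fun z => c * f z) = FunGerm.of S.U fun z => c * deriv f z
        refine FunGerm.of_eq_of ?_
        filter_upwards [df] with z hf
        exact deriv_const_mul c hf }
    (by
      rintro ⟨f, hf⟩ ⟨g, hg⟩
      apply Subtype.ext
      obtain ⟨f, rfl, df⟩ := S.isHolomorphic f hf
      obtain ⟨g, rfl, dg⟩ := S.isHolomorphic g hg
      change FunGerm.of S.U (deriv (f * g)) = FunGerm.of S.U (f * deriv g + g * deriv f)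
      refine FunGerm.of_eq_of ?_
      filter_upwards [df, dg] with z hf hg
      rw [deriv_mul hf hg]
      simp only [Pi.add_apply, Pi.mul_apply]
      ring)

/-- The derivation `δ_z = -½ ∂_z` of `R`. -/
def deltaZ : Derivation ℂ S.R S.R := (-(1 / 2) : ℂ) • S.partialZ

/-- The ring `C₀ = R[[y ; δ_z]]₂`. -/
abbrev C₀ : Type := QuadSeries S.deltaZ

/-- The homographic action `f · γ` on `R`. -/
def act (γ : Γ) (f : S.R) : S.R :=
  ⟨Germ.compTendsto (f : FunGerm S.U) (moebius γ)
    (tendsto_moebius γ (S.moebius_mem γ γ.2)), S.comp_mem γ γ.2 f f.2⟩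

/-- The unit `s_γ = c z + d` of `R`. -/
def s (γ : Γ) : (S.R)ˣ := (S.isUnit_autFactor γ γ.2).choose

theorem s_spec (γ : Γ) : ((S.s γ : S.R) : FunGerm S.U) = FunGerm.of S.U (autFactor γ) :=
  (S.isUnit_autFactor γ γ.2).choose_spec

/-- The weight `k` action `(f|_k γ)(z) = (c z + d)^(-k) f ((a z + b) / (c z + d))` on `R`. -/
def slash (k : ℤ) (γ : Γ) (f : S.R) : S.R := ((S.s γ ^ (-k) : (S.R)ˣ) : S.R) * S.act γ f

/-- The variable `y` of `C₀`. -/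
def y : S.C₀ := QuadSeries.single 1 1

/-- `x · γ = x (c z + d)⁻²` in `C₀`, where `x = y²`. -/
def xAct (γ : Γ) : S.C₀ := S.y ^ 2 * QuadSeries.single 0 ((S.s γ ^ (-2 : ℤ) : (S.R)ˣ) : S.R)

theorem existsUnique_yAct (γ : Γ) : ∃! p : S.C₀, QuadSeries.coeff 0 p = 0 ∧
    QuadSeries.coeff 1 p = (((S.s γ)⁻¹ : (S.R)ˣ) : S.R) ∧ p ^ 2 = S.xAct γ := by
  have hy : ∀ i < 1, QuadSeries.coeff i S.y = 0 := fun i hi => if_neg (by omega)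
  have hyy : ∀ i < 2, QuadSeries.coeff i (S.y ^ 2) = 0 := fun i hi => by
    rw [pow_two]; exact QuadSeries.coeff_mul_low hy hy (by omega)
  have h0 : ∀ (r : S.R), ∀ j < 0, QuadSeries.coeff j (QuadSeries.single 0 r : S.C₀) = 0 :=
    fun r j hj => absurd hj (Nat.not_lt_zero j)
  apply QuadSeries.existsUnique_sqrt
  · exact QuadSeries.coeff_mul_low hyy (h0 _) (by omega)
  · exact QuadSeries.coeff_mul_low hyy (h0 _) (by omega)
  · have h2 := QuadSeries.coeff_mul_lead hyy (h0 ((S.s γ ^ (-2 : ℤ) : (S.R)ˣ) : S.R))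
    have h1 : QuadSeries.coeff 2 (S.y ^ 2) = 1 := by
      rw [pow_two]
      have := QuadSeries.coeff_mul_lead hy hy
      rw [show (1 + 1 : ℕ) = 2 from rfl] at this
      rw [this, show QuadSeries.coeff 1 S.y = 1 from
        (QuadSeries.coeff_single 1 1 1).trans (if_pos rfl), one_mul]
    rw [h1, one_mul] at h2
    refine h2.trans ((QuadSeries.coeff_single 0 0 _).trans ?_)
    rw [if_pos rfl, zpow_neg, ← Units.val_pow_eq_pow_val, inv_pow]
    rfl

/-- `y · γ`: the square root of `x · γ` in `C₀` whose term of minimal valuation is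
`(c z + d)⁻¹ y`. -/
def yAct (γ : Γ) : S.C₀ := (S.existsUnique_yAct γ).choose

/-- The action of `Γ` on `C₀`: `(∑ fₙ yⁿ) · γ = ∑ (fₙ · γ) (y · γ)ⁿ`. As `y · γ` has no constant
term, only the terms with `n ≤ N` contribute to the coefficient of `y ^ N`. -/
def actC (γ : Γ) (q : S.C₀) : S.C₀ :=
  QuadSeries.mk fun N => ∑ n ∈ range (N + 1),
    S.act γ (QuadSeries.coeff n q) * QuadSeries.coeff N (S.yAct γ ^ n)

/-- The linear map `f ↦ ∑ₙ α(n) f⁽ⁿ⁾ y ^ (m + 2 n)` from `R` to `C₀`. -/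
def diffSeries (m : ℕ) (α : ℕ → ℂ) : S.R →ₗ[ℂ] S.C₀ where
  toFun f := QuadSeries.mk fun N => if m ≤ N ∧ Even (N - m) then
    α ((N - m) / 2) • (S.partialZ^[(N - m) / 2]) f else 0
  map_add' f g := QuadSeries.ext' fun N => by
    simp only [QuadSeries.coeff_add, QuadSeries.coeff_mk, QuadSeries.iterate_map_add, smul_add]
    split_ifs <;> simp
  map_smul' c f := QuadSeries.ext' fun N => by
    change (if m ≤ N ∧ Even (N - m) then
        α ((N - m) / 2) • (S.partialZ^[(N - m) / 2]) (c • f) else 0)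
      = c • (if m ≤ N ∧ Even (N - m) then α ((N - m) / 2) • (S.partialZ^[(N - m) / 2]) f else 0)
    rw [QuadSeries.iterate_map_smul]
    split_ifs
    · rw [smul_comm]
    · simp

/-- Equivariance: `ψ (f|_m γ) = ψ(f) · γ` for all `γ ∈ Γ` and `f ∈ R`. -/
def IsEquivariant (m : ℕ) (ψ : S.R →ₗ[ℂ] S.C₀) : Prop :=
  ∀ (γ : Γ) (f : S.R), ψ (S.slash m γ f) = S.actC γ (ψ f)

/-- `ψ` is equivariant and of the form `f ↦ ∑ₙ α(n) f⁽ⁿ⁾ y ^ (m + 2 n)` with `α(0) = 1`. -/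
def IsLift (m : ℕ) (ψ : S.R →ₗ[ℂ] S.C₀) : Prop :=
  S.IsEquivariant m ψ ∧ ∃ α : ℕ → ℂ, ψ = S.diffSeries m α ∧ α 0 = 1

end FunctionAlgebra

/-- `(-1)ⁿ / (4ⁿ n!) ∏_{i=0}^{n-1} (m + 2 i) (m + 2 i + 2) / (m + i)` (used for `m > 0`). -/
def liftCoeff (m n : ℕ) : ℂ :=
  (-1) ^ n / (4 ^ n * (n.factorial : ℂ)) *
    ∏ i ∈ range n, ((m : ℂ) + 2 * i) * ((m : ℂ) + 2 * i + 2) / ((m : ℂ) + i)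

/-- The sequence `1, -c, c, -c, …`. -/
def liftCoeffZero (c : ℂ) (n : ℕ) : ℂ := if n = 0 then 1 else c * (-1) ^ n

end Homographic

end

/-! Write u = (c z + d)⁻¹, so ∂u = -c u² and δu = (c/2) u². Everything rests on two expansions in
powers of u.

The first is the closed form (y·γ)ⁱ = ∑ᵣ κ(i, r) cʳ u^(i+r) y^(i+2r), with κ(x, r) = ∏_{j<r}
(x+2j)(x+2j+2) / (4(j+1)) (`confCoeff`, `yAct_pow`). Let Yᵢ be the right-hand side. Since y² f = ∑ₖ
2ᵏ δᵏ(f) y^(2+2k), left multiplication by y² u² is a first-order recursion on coefficients, and a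
recursion for κ gives (y² u²) Yⱼ = Yⱼ₊₂, hence Y₂ₐ Yⱼ = Y₂ₐ₊ⱼ by associativity. Odd indices come by
interpolation: the numerical coefficients of Yᵢ Yⱼ and of Yᵢ₊ⱼ are polynomials in i that agree at
every even i, so they are equal (`confMul_eq`). In particular Y₁² = Y₂ = y² u², and uniqueness of
the square root identifies Y₁ with y·γ.

The second is Bol's formula: iterating (f·γ)' = u² (f'·γ) expands (f|ₘγ)⁽ⁿ⁾ over k + r = n in the
terms u^(m+2k+r) (f⁽ᵏ⁾·γ) (`iterate_pow_mul`).

Comparing the two sides of (C1) degree by degree, equivariance says that a combination of those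
terms vanishes, whose scalar at (k, r) is cʳ times the defect of the relation `Compatible m α k r`.
If all these relations hold, the map is equivariant; the stated sequences satisfy them. Conversely,
when c ≠ 0, the test function f = 1 kills all terms but k = 0, and f = c z + d leaves only k ≤ 1.
For m > 0 the relations with k = 0 determine α from α(0), because m(m+1)⋯(m+n-1) ≠ 0. For m = 0 they
are void for n > 0, and those with k = 1 determine α(n+1) from α(1), which stays free: this is the
parameter c₀ = -α(1). -/

noncomputable section

/-! ### Series whose exponents advance by steps of two -/

namespace QuadSeries

open Finset

variable {R : Type*} [CommRing R] [Algebra ℂ R] {δ : Derivation ℂ R R}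

/-- The series `∑ aᵣ y ^ (i + 2 r)`. -/
def stepSeries (i : ℕ) (a : ℕ → R) : QuadSeries δ :=
  mk fun n => if i ≤ n ∧ Even (n - i) then a ((n - i) / 2) else 0

theorem coeff_stepSeries (i r : ℕ) (a : ℕ → R) :
    coeff (i + 2 * r) (stepSeries i a : QuadSeries δ) = a r := by
  rw [stepSeries, coeff_mk, if_pos ⟨by omega, by simp⟩]
  congr 1; omega

theorem coeff_stepSeries_eq_zero {i n : ℕ} (a : ℕ → R) (h : ∀ r, n ≠ i + 2 * r) :
    coeff n (stepSeries i a : QuadSeries δ) = 0 := by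
  rw [stepSeries, coeff_mk, if_neg]
  rintro ⟨h1, r, hr⟩
  exact h r (by omega)

theorem eq_stepSeries_iff {i : ℕ} {a : ℕ → R} {q : QuadSeries δ} :
    q = stepSeries i a ↔ (∀ r, coeff (i + 2 * r) q = a r) ∧
      ∀ n, (∀ r, n ≠ i + 2 * r) → coeff n q = 0 := by
  constructor
  · rintro rfl
    exact ⟨fun r => coeff_stepSeries i r a, fun n hn => coeff_stepSeries_eq_zero a hn⟩
  · rintro ⟨h1, h2⟩
    refine ext' fun n => ?_
    by_cases h : ∀ r, n ≠ i + 2 * r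
    · rw [h2 n h, coeff_stepSeries_eq_zero a h]
    · push Not at h
      obtain ⟨r, rfl⟩ := h
      rw [h1, coeff_stepSeries]

theorem single_eq_stepSeries (n : ℕ) (f : R) :
    (single n f : QuadSeries δ) = stepSeries n fun r => if r = 0 then f else 0 := by
  refine eq_stepSeries_iff.mpr ⟨fun r => ?_, fun k hk => ?_⟩
  · rw [coeff_single]
    refine if_congr (by omega) rfl rfl
  · rw [coeff_single, if_neg (by simpa using hk 0)]

/-- Reindexes a sum over all exponents when only those in the progression i, i + 2, …, i + 2 r
contribute. -/
theorem sum_range_step {A : Type*} [AddCommMonoid A] {N i r : ℕ} (hN : i + 2 * r < N) (F : ℕ → A)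
    (hF : ∀ n, (∀ t ≤ r, n ≠ i + 2 * t) → F n = 0) :
    ∑ n ∈ range N, F n = ∑ t ∈ range (r + 1), F (i + 2 * t) := by
  symm
  refine sum_of_injOn (fun t => i + 2 * t) (fun a _ b _ h => ?_) (fun t ht => ?_)
    (fun n _ hn => hF n fun t ht h => hn ⟨t, by simpa using Nat.lt_succ_of_le ht, h.symm⟩) (fun _ _ => rfl)
  · simp only at h; omega
  · simp only [coe_range, Set.mem_Iio] at ht ⊢; omega

/-- The coefficients of the product of `∑ aᵣ y ^ (i + 2 r)` and `∑ bᵣ y ^ (j + 2 r)`. -/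
def stepMul (δ : Derivation ℂ R R) (i : ℕ) (a b : ℕ → R) (r : ℕ) : R :=
  ∑ t ∈ range (r + 1), ∑ k ∈ range (r + 1), ∑ l ∈ range (r + 1),
    if t + k + l = r then quadCoeff (i + 2 * t) k • (a t * (δ^[k]) (b l)) else 0

theorem stepSeries_mul (i j : ℕ) (a b : ℕ → R) :
    (stepSeries i a * stepSeries j b : QuadSeries δ) = stepSeries (i + j) (stepMul δ i a b) := by
  refine eq_stepSeries_iff.mpr ⟨fun r => ?_, fun n hn => ?_⟩
  · rw [coeff_mul_box (Nat.lt_succ_self _), stepMul, sum_range_step (i := i) (r := r)]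
    · refine sum_congr rfl fun t ht => ?_
      -- The box bounds k by the total degree; the terms with k > r vanish for degree reasons, since
      -- both factors only have exponents at least i and j.
      rw [← sum_subset (range_subset_range.mpr (show r + 1 ≤ _ by omega))]
      · refine sum_congr rfl fun k hk => ?_
        rw [sum_range_step (i := j) (r := r) (by omega)]
        · refine sum_congr rfl fun l hl => ?_
          rw [coeff_stepSeries, coeff_stepSeries]
          exact if_congr (by omega) rfl rfl
        · intro n hn
          split_ifs with h
          · rw [coeff_stepSeries_eq_zero b fun l hl => hn l (by omega) hl, iterate_map_zero]; simp
          · rfl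
      · intro k _ hk
        rw [mem_range] at hk
        exact sum_eq_zero fun l _ => by
          split_ifs with h
          · rw [coeff_stepSeries_eq_zero b fun l' hl => by omega, iterate_map_zero]; simp
          · rfl
    · omega
    · intro n hn
      refine sum_eq_zero fun k _ => sum_eq_zero fun l _ => ?_
      split_ifs with h
      · by_cases hl : ∀ l', l ≠ j + 2 * l'
        · rw [coeff_stepSeries_eq_zero b hl, iterate_map_zero]; simp
        · push Not at hl
          obtain ⟨l', rfl⟩ := hl
          rw [coeff_stepSeries_eq_zero a fun t ht => hn t (by omega) ht]; simp
      · rfl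
  · rw [coeff_mul_box (Nat.lt_succ_self _)]
    refine sum_eq_zero fun t _ => sum_eq_zero fun k _ => sum_eq_zero fun l _ => ?_
    split_ifs with h
    · by_cases hl : ∀ l', l ≠ j + 2 * l'
      · rw [coeff_stepSeries_eq_zero b hl, iterate_map_zero]; simp
      · push Not at hl
        obtain ⟨l', rfl⟩ := hl
        rw [coeff_stepSeries_eq_zero a fun t' ht => hn (t' + k + l') (by omega)]; simp
    · rfl

theorem single_zero_mul_stepSeries (f : R) (j : ℕ) (b : ℕ → R) :
    (single 0 f * stepSeries j b : QuadSeries δ) = stepSeries j fun r => f * b r := by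
  refine eq_stepSeries_iff.mpr ⟨fun r => ?_, fun n hn => ?_⟩
  · rw [single_eq_stepSeries, stepSeries_mul, show j + 2 * r = 0 + j + 2 * r by omega,
      coeff_stepSeries, stepMul, sum_eq_single 0, sum_eq_single 0, sum_eq_single r]
    · simp [quadCoeff_zero_right]
    · intro l _ hl; rw [if_neg (by omega)]
    · simp
    · intro k _ hk
      obtain ⟨k, rfl⟩ := Nat.exists_eq_succ_of_ne_zero hk
      simp [quadCoeff_zero_left]
    · simp
    · intro t _ ht; simp [ht]
    · simp
  · rw [single_eq_stepSeries, stepSeries_mul]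
    exact coeff_stepSeries_eq_zero _ (by simpa using hn)

theorem quadCoeff_two (k : ℕ) : quadCoeff 2 k = 2 ^ k := by
  rw [quadCoeff, ← card_range k, ← prod_const, card_range]
  refine prod_congr rfl fun j _ => ?_
  have : (j : ℂ) + 1 ≠ 0 := by exact_mod_cast Nat.succ_ne_zero j
  push_cast; field_simp; ring

/-- Because `quadCoeff 2 k` is the geometric sequence 2ᵏ, the coefficients of y² (∑ bᵣ y^(j+2r)) are
∑ₖ 2ᵏ δᵏ(b_{r-k}), which is the solution of the recursion `hw`. Checking a product with y² thus
needs only one derivative. -/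
theorem single_two_mul_stepSeries (j : ℕ) (b w : ℕ → R) (h0 : w 0 = b 0)
    (hw : ∀ r, w (r + 1) = b (r + 1) + (2 : ℂ) • δ (w r)) :
    (single 2 1 * stepSeries j b : QuadSeries δ) = stepSeries (j + 2) w := by
  rw [single_eq_stepSeries, stepSeries_mul, add_comm 2 j]
  congr 1
  have hsum : ∀ r, w r = ∑ p ∈ antidiagonal r, (2 : ℂ) ^ p.1 • (δ^[p.1]) (b p.2) := by
    intro r
    induction r with
    | zero => simp [h0]
    | succ r ih =>
      rw [hw, ih, Nat.sum_antidiagonal_succ, map_sum, smul_sum]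
      simp [pow_succ', smul_smul, Function.iterate_succ_apply', Derivation.map_smul]
  funext r
  rw [hsum, stepMul, sum_eq_single 0, Finset.Nat.sum_antidiagonal_eq_sum_range_succ_mk]
  · refine sum_congr rfl fun k hk => ?_
    rw [mem_range] at hk
    rw [sum_eq_single (r - k)]
    · simp [quadCoeff_two, show k + (r - k) = r by omega]
    · intro l _ hl; rw [if_neg (by omega)]
    · intro h; exact absurd (mem_range.mpr (by omega)) h
  · intro t _ ht; simp [ht]
  · simp

theorem single_one_sq : (single 1 1 : QuadSeries δ) ^ 2 = single 2 1 := by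
  rw [pow_two]
  conv_lhs => rw [single_eq_stepSeries, stepSeries_mul]
  rw [single_eq_stepSeries]
  congr 1
  funext r
  have h1 : ∀ (k l : ℕ), (δ^[k]) (if l = 0 then (1 : R) else 0) = if k = 0 ∧ l = 0 then 1 else 0 := by
    intro k l
    rcases k with _ | k
    · simp
    · rcases l with _ | l
      · simp [iterate_map_one]
      · simp
  rw [stepMul, sum_eq_single 0, sum_eq_single 0, sum_eq_single 0]
  · simp [quadCoeff_zero_right, eq_comm]
  · intro l _ hl; simp [hl]
  · simp
  · intro k _ hk; simp [h1, hk]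
  · simp
  · intro t _ ht; simp [ht]
  · simp

end QuadSeries

/-! ### The powers of y·γ: numerical coefficients and polynomial interpolation -/

namespace QuadSeries

open Finset

/-- Functions `ℂ → ℂ` given by a polynomial. -/
def polyFun : Subalgebra ℂ (ℂ → ℂ) := (Polynomial.aeval (id : ℂ → ℂ)).range

theorem id_mem_polyFun : (fun x => x) ∈ polyFun := ⟨Polynomial.X, by simp; rfl⟩

theorem const_mem_polyFun (c : ℂ) : (fun _ => c) ∈ polyFun := polyFun.algebraMap_mem c

/-- The even natural numbers are infinitely many, so two polynomials agreeing there coincide. -/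
theorem eq_of_mem_polyFun {f g : ℂ → ℂ} (hf : f ∈ polyFun) (hg : g ∈ polyFun)
    (h : ∀ a : ℕ, f (2 * a) = g (2 * a)) : f = g := by
  obtain ⟨P, rfl⟩ := hf
  obtain ⟨Q, rfl⟩ := hg
  have e : ∀ (P : Polynomial ℂ) (x : ℂ), Polynomial.aeval (id : ℂ → ℂ) P x = P.eval x := by
    intro P x
    rw [Polynomial.aeval_fn_apply]
    simp
  have : P = Q := by
    refine Polynomial.eq_of_infinite_eval_eq P Q
      ((Set.infinite_range_of_injective (f := fun a : ℕ => (2 * a : ℂ)) fun a b hab => ?_).mono ?_)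
    · simpa using hab
    · rintro _ ⟨a, rfl⟩
      simpa [e] using h a
  rw [this]

/-- `∏_{j < r} (x + 2 j) (x + 2 j + 2) / (4 (j + 1))`. -/
def confCoeff (x : ℂ) (r : ℕ) : ℂ :=
  ∏ j ∈ range r, (x + 2 * j) * (x + 2 * j + 2) / (4 * ((j : ℂ) + 1))

theorem confCoeff_zero_right (x : ℂ) : confCoeff x 0 = 1 := by simp [confCoeff]

theorem confCoeff_succ (x : ℂ) (r : ℕ) :
    confCoeff x (r + 1) = confCoeff x r * ((x + 2 * r) * (x + 2 * r + 2) / (4 * ((r : ℂ) + 1))) := by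
  rw [confCoeff, prod_range_succ, ← confCoeff]

theorem confCoeff_zero_left (r : ℕ) : confCoeff 0 (r + 1) = 0 := by
  simp [confCoeff, prod_range_succ']

/-- The numerator factors for x + 2 are those for x with the index moved by one; only the factor j =
0 and the last denominator remain. -/
theorem confCoeff_shift (x : ℂ) (r : ℕ) :
    4 * ((r : ℂ) + 1) * confCoeff x (r + 1) = x * (x + 2) * confCoeff (x + 2) r := by
  induction r with
  | zero => simp [confCoeff]; ring
  | succ r ih =>
    have h1 : (r : ℂ) + 1 ≠ 0 := by exact_mod_cast Nat.succ_ne_zero r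
    have h2 : (r : ℂ) + 1 + 1 ≠ 0 := by exact_mod_cast Nat.succ_ne_zero (r + 1)
    rw [confCoeff_succ _ (r + 1), confCoeff_succ (x + 2)]
    push_cast
    field_simp
    linear_combination (x + 2 * (r + 1)) * (x + 2 * (r + 1) + 2) * ih

/-- This is the recursion behind multiplication by y² u². All three terms are multiples of κ(x+2,
r), and the identity reduces to (x+2r+2)(x+2r+4) - x(x+2) = 4(r+1)(x+2+r). -/
theorem confCoeff_add_two (x : ℂ) (r : ℕ) :
    confCoeff (x + 2) (r + 1) = confCoeff x (r + 1) + (x + 2 + r) * confCoeff (x + 2) r := by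
  have h1 : (r : ℂ) + 1 ≠ 0 := by exact_mod_cast Nat.succ_ne_zero r
  have := confCoeff_shift x r
  have h4 : 4 * ((r : ℂ) + 1) ≠ 0 := mul_ne_zero (by norm_num) h1
  apply mul_left_cancel₀ h4
  rw [mul_add _ (confCoeff x (r + 1)), this, confCoeff_succ]
  field_simp
  ring

/-- The numerical coefficients of the product of two series `confSeries`. -/
def confMul (x : ℂ) (j r : ℕ) : ℂ :=
  ∑ t ∈ range (r + 1), ∑ k ∈ range (r + 1), ∑ l ∈ range (r + 1),
    if t + k + l = r then
      (confCoeff x t * ∏ p ∈ range k, (x + 2 * t + 2 * p) / ((p : ℂ) + 1)) *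
        (confCoeff j l * ∏ p ∈ range k, ((j + l + p : ℕ) : ℂ) / 2) else 0

theorem sum_mem_polyFun {s : Finset ℕ} {f : ℕ → ℂ → ℂ} (h : ∀ i ∈ s, f i ∈ polyFun) :
    (fun x => ∑ i ∈ s, f i x) ∈ polyFun := by
  have := sum_mem h
  convert this using 1
  funext x; simp

theorem prod_mem_polyFun {s : Finset ℕ} {f : ℕ → ℂ → ℂ} (h : ∀ i ∈ s, f i ∈ polyFun) :
    (fun x => ∏ i ∈ s, f i x) ∈ polyFun := by
  have := prod_mem h
  convert this using 1
  funext x; simp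

theorem add_const_mem_polyFun (c : ℂ) : (fun x => x + c) ∈ polyFun :=
  add_mem id_mem_polyFun (const_mem_polyFun c)

theorem confCoeff_mem_polyFun (c : ℂ) (r : ℕ) : (fun x => confCoeff (x + c) r) ∈ polyFun := by
  refine prod_mem_polyFun fun j _ => ?_
  simp_rw [div_eq_mul_inv, add_assoc]
  exact mul_mem (mul_mem (add_const_mem_polyFun _) (add_const_mem_polyFun _)) (const_mem_polyFun _)

theorem confMul_mem_polyFun (j r : ℕ) : (fun x => confMul x j r) ∈ polyFun := by
  refine sum_mem_polyFun fun t _ => sum_mem_polyFun fun k _ => sum_mem_polyFun fun l _ => ?_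
  split_ifs
  · refine mul_mem (mul_mem ?_ (prod_mem_polyFun fun p _ => ?_)) (const_mem_polyFun _)
    · simpa using confCoeff_mem_polyFun 0 t
    · simp_rw [div_eq_mul_inv, add_assoc]
      exact mul_mem (add_const_mem_polyFun _) (const_mem_polyFun _)
  · exact const_mem_polyFun 0

variable {R : Type*} [CommRing R] [Algebra ℂ R] {δ : Derivation ℂ R R}

/-- The image `∑ confCoeff i r · cʳ u ^ (i + r) y ^ (i + 2 r)` of `yⁱ` under the action of a
homography with `u = (c z + d)⁻¹`. -/
def confSeries (δ : Derivation ℂ R R) (c : ℂ) (u : R) (i : ℕ) : QuadSeries δ :=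
  stepSeries i fun r => (confCoeff i r * c ^ r) • u ^ (i + r)

theorem derivation_pow {c : ℂ} {u : R} (hu : δ u = (c / 2) • u ^ 2) (n : ℕ) :
    δ (u ^ n) = (n * c / 2) • u ^ (n + 1) := by
  rw [Derivation.leibniz_pow, hu]
  rcases n with _ | n
  · simp
  · simp only [Nat.add_sub_cancel, smul_eq_mul, mul_smul_comm, ← pow_add, ← Nat.cast_smul_eq_nsmul ℂ,
      smul_smul]
    rw [add_assoc]
    congr 1
    push_cast; ring

theorem derivation_iterate_pow {c : ℂ} {u : R} (hu : δ u = (c / 2) • u ^ 2) (n k : ℕ) :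
    (δ^[k]) (u ^ n) = ((∏ p ∈ range k, ((n + p : ℕ) : ℂ) / 2) * c ^ k) • u ^ (n + k) := by
  induction k with
  | zero => simp
  | succ k ih =>
    rw [Function.iterate_succ_apply', ih, Derivation.map_smul, derivation_pow hu, smul_smul,
      prod_range_succ, add_assoc]
    congr 1
    ring

/-- Every derivative of a power of u is a scalar times a power of u, so the product is governed by
numbers alone; all terms of the same degree share the monomial cʳ u^(i+j+r). -/
theorem stepMul_conf {c : ℂ} {u : R} (hu : δ u = (c / 2) • u ^ 2) (i j r : ℕ) :
    stepMul δ i (fun r => (confCoeff i r * c ^ r) • u ^ (i + r))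
      (fun r => (confCoeff j r * c ^ r) • u ^ (j + r)) r = (confMul i j r * c ^ r) • u ^ (i + j + r) := by
  simp only [stepMul, confMul, sum_mul, sum_smul]
  refine sum_congr rfl fun t _ => sum_congr rfl fun k _ => sum_congr rfl fun l _ => ?_
  split_ifs with h
  · rw [iterate_map_smul, derivation_iterate_pow hu, smul_smul, smul_mul_smul_comm, ← pow_add,
      smul_smul, quadCoeff]
    have e : i + t + (j + l + k) = i + j + r := by omega
    rw [e, ← h, pow_add, pow_add]
    congr 1
    push_cast
    ring
  · simp

theorem confSeries_zero (c : ℂ) (u : R) : confSeries δ c u 0 = 1 := by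
  change _ = single 0 1
  rw [single_eq_stepSeries, confSeries]
  congr 1
  funext r
  rcases r with _ | r
  · simp [confCoeff_zero_right]
  · simp [confCoeff_zero_left]

/-- Under the recursion of `single_two_mul_stepSeries`, 2δ(u^(j+2+r)) = (j+2+r) c u^(j+3+r), which
is exactly the correction term in `confCoeff_add_two`. -/
theorem sq_mul_confSeries {c : ℂ} {u : R} (hu : δ u = (c / 2) • u ^ 2) (j : ℕ) :
    (single 1 1 ^ 2 * single 0 (u ^ 2)) * confSeries δ c u j = confSeries δ c u (j + 2) := by
  rw [mul_assoc, confSeries, single_zero_mul_stepSeries, single_one_sq]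
  refine single_two_mul_stepSeries _ _ _ ?_ fun r => ?_
  · simp only [confCoeff_zero_right, mul_smul_comm, ← pow_add]
    simp [add_comm]
  · simp only [Derivation.map_smul, derivation_pow hu, mul_smul_comm, ← pow_add, smul_smul]
    rw [show 2 + (j + (r + 1)) = j + 2 + (r + 1) by omega, add_assoc (j + 2) r 1, ← add_smul]
    congr 1
    push_cast
    rw [confCoeff_add_two]
    ring

theorem confSeries_two {c : ℂ} {u : R} (hu : δ u = (c / 2) • u ^ 2) :
    confSeries δ c u 2 = single 1 1 ^ 2 * single 0 (u ^ 2) := by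
  rw [← sq_mul_confSeries hu 0, confSeries_zero, mul_one]

theorem confSeries_even_mul {c : ℂ} {u : R} (hu : δ u = (c / 2) • u ^ 2) (a j : ℕ) :
    confSeries δ c u (2 * a) * confSeries δ c u j = confSeries δ c u (2 * a + j) := by
  induction a with
  | zero => simp [confSeries_zero]
  | succ a ih =>
    rw [mul_add_one, ← sq_mul_confSeries hu, mul_assoc, ih, sq_mul_confSeries hu]
    congr 1; omega

/-- A purely numerical identity deduced from the ring structure: for x = 2a it is a comparison of
coefficients in `confSeries_even_mul`, where cʳ and the power of u can be cancelled, and both sides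
are polynomial in x. -/
theorem confMul_eq [IsDomain R] {c : ℂ} {u : R} (hu : δ u = (c / 2) • u ^ 2) (hc : c ≠ 0)
    (hu0 : u ≠ 0) (x : ℂ) (j r : ℕ) : confMul x j r = confCoeff (x + j) r := by
  refine congrFun (eq_of_mem_polyFun (confMul_mem_polyFun j r) (confCoeff_mem_polyFun j r)
    fun a => ?_) x
  have h := congrArg (coeff (2 * a + j + 2 * r)) (confSeries_even_mul hu a j)
  simp only [confSeries, stepSeries_mul, coeff_stepSeries, stepMul_conf hu] at h
  have h1 := smul_left_injective ℂ (pow_ne_zero _ hu0) h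
  have h2 := mul_right_cancel₀ (pow_ne_zero _ hc) h1
  simpa using h2

theorem confSeries_mul [IsDomain R] {c : ℂ} {u : R} (hu : δ u = (c / 2) • u ^ 2) (hu0 : u ≠ 0)
    (i j : ℕ) : confSeries δ c u i * confSeries δ c u j = confSeries δ c u (i + j) := by
  simp only [confSeries, stepSeries_mul]
  congr 1
  funext r
  rw [stepMul_conf hu]
  -- For c = 0 nothing can be cancelled, but then only the coefficient r = 0 survives.
  by_cases hc : c = 0
  · rcases r with _ | r
    · simp [confMul, confCoeff_zero_right]
    · simp [hc]
  · rw [confMul_eq hu hc hu0, Nat.cast_add]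

theorem confSeries_one_pow [IsDomain R] {c : ℂ} {u : R} (hu : δ u = (c / 2) • u ^ 2) (hu0 : u ≠ 0)
    (n : ℕ) : confSeries δ c u 1 ^ n = confSeries δ c u n := by
  induction n with
  | zero => rw [pow_zero, confSeries_zero]
  | succ n ih => rw [pow_succ, ih, confSeries_mul hu hu0]

end QuadSeries

/-! ### Derivatives of weighted functions and the relations on coefficients -/

namespace Homographic

open Finset Filter QuadSeries

/-- Bol-type formula for the iterated derivatives of `u ^ m g₀` when `u' = -c u²` and
`gₖ' = u² gₖ₊₁`. -/
theorem iterate_pow_mul {R : Type*} [CommRing R] [Algebra ℂ R] (D : Derivation ℂ R R) {c : ℂ}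
    {u : R} (hu : D u = (-c) • u ^ 2) {g : ℕ → R} (hg : ∀ k, D (g k) = u ^ 2 * g (k + 1))
    (m n : ℕ) :
    (D^[n]) (u ^ m * g 0) = ∑ p ∈ antidiagonal n,
      ((((p.1 + p.2).choose p.1 : ℕ) : ℂ) * (∏ l ∈ range p.2, ((m : ℂ) + p.1 + l)) * (-c) ^ p.2) •
        (u ^ (m + 2 * p.1 + p.2) * g p.1) := by
  have hpow : ∀ n : ℕ, D (u ^ n) = (n * -c : ℂ) • u ^ (n + 1) := fun n => by
    -- `derivation_pow` is normalised for δ, where the derivative of u is (c/2) u²; here it is -c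
    -- u².
    rw [derivation_pow (c := 2 * -c) (by rw [hu]; congr 1; ring)]
    congr 1; ring
  have hstep : ∀ k r : ℕ, D (u ^ (m + 2 * k + r) * g k)
      = ((m + 2 * k + r : ℂ) * -c) • (u ^ (m + 2 * k + (r + 1)) * g k)
        + u ^ (m + 2 * (k + 1) + r) * g (k + 1) := fun k r => by
    rw [Derivation.leibniz, hpow, hg, smul_eq_mul, smul_eq_mul, mul_smul_comm, ← mul_assoc,
      ← pow_add, add_comm, mul_comm (g k), show m + 2 * k + r + 2 = m + 2 * (k + 1) + r by omega]
    congr 2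
    push_cast; ring
  induction n with
  | zero => simp
  | succ n ih =>
    -- `H1` collects the terms where the new derivative falls on the power of u (r increases), `H2`
    -- those where it falls on g (k increases). Each is reindexed to level n + 1, with the value 0
    -- at the index that is not reached.
    let H1 : ℕ → ℕ → ℂ := fun k r => Nat.casesOn r 0 fun r =>
      ((((k + r).choose k : ℕ) : ℂ) * (∏ l ∈ range r, ((m : ℂ) + k + l)) * (-c) ^ r)
        * ((m + 2 * k + r : ℂ) * -c)
    let H2 : ℕ → ℕ → ℂ := fun k r => Nat.casesOn k 0 fun k =>
      (((k + r).choose k : ℕ) : ℂ) * (∏ l ∈ range r, ((m : ℂ) + k + l)) * (-c) ^ r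
    have H1_zero : ∀ k, H1 k 0 = 0 := fun _ => rfl
    have H1_succ : ∀ k r, H1 k (r + 1) = ((((k + r).choose k : ℕ) : ℂ) *
      (∏ l ∈ range r, ((m : ℂ) + k + l)) * (-c) ^ r) * ((m + 2 * k + r : ℂ) * -c) :=
      fun _ _ => rfl
    have H2_zero : ∀ r, H2 0 r = 0 := fun _ => rfl
    have H2_succ : ∀ k r, H2 (k + 1) r = (((k + r).choose k : ℕ) : ℂ) *
      (∏ l ∈ range r, ((m : ℂ) + k + l)) * (-c) ^ r := fun _ _ => rfl
    have hH : ∀ k r : ℕ, k + r = n + 1 →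
        (((k + r).choose k : ℕ) : ℂ) * (∏ l ∈ range r, ((m : ℂ) + k + l)) * (-c) ^ r
          = H1 k r + H2 k r := by
      intro k r hkr
      rcases r with _ | r
      · rcases k with _ | k
        · omega
        · simp [H1_zero, H2_succ]
      · rcases k with _ | k
        · simp only [H1_succ, H2_zero, Nat.choose_zero_right, prod_range_succ, pow_succ]
          push_cast; ring
        · have e1 : (((k + 1 + (r + 1)).choose (k + 1) : ℕ) : ℂ)
              = (((k + (r + 1)).choose k : ℕ) : ℂ) + (((k + 1 + r).choose (k + 1) : ℕ) : ℂ) := by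
            rw [show k + 1 + (r + 1) = k + (r + 1) + 1 by omega, Nat.choose_succ_succ,
              show k + (r + 1) = k + 1 + r by omega]
            push_cast; rfl
          have e2 : (((k + (r + 1)).choose k : ℕ) : ℂ) * (r + 1)
              = (((k + 1 + r).choose (k + 1) : ℕ) : ℂ) * (k + 1) := by
            have := Nat.choose_succ_right_eq (k + (r + 1)) k
            rw [show k + (r + 1) - k = r + 1 by omega] at this
            rw [show k + 1 + r = k + (r + 1) by omega]
            exact_mod_cast this.symm
          have e3 : ∏ l ∈ range (r + 1), ((m : ℂ) + (k : ℕ) + l)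
              = (m + k) * ∏ l ∈ range r, ((m : ℂ) + (k + 1 : ℕ) + l) := by
            rw [prod_range_succ', mul_comm]
            simp only [Nat.cast_zero, add_zero]
            congr 1
            refine prod_congr rfl fun l _ => ?_
            push_cast; ring
          simp only [H1_succ, H2_succ]
          rw [e3, e1, prod_range_succ]
          push_cast
          linear_combination (∏ l ∈ range r, ((m : ℂ) + (k + 1) + l)) * (-c) ^ (r + 1) * e2
    rw [Function.iterate_succ_apply', ih, map_sum]
    have hR : ∑ p ∈ antidiagonal (n + 1),
        ((((p.1 + p.2).choose p.1 : ℕ) : ℂ) * (∏ l ∈ range p.2, ((m : ℂ) + p.1 + l)) * (-c) ^ p.2) •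
          (u ^ (m + 2 * p.1 + p.2) * g p.1)
        = ∑ p ∈ antidiagonal (n + 1), H1 p.1 p.2 • (u ^ (m + 2 * p.1 + p.2) * g p.1)
          + ∑ p ∈ antidiagonal (n + 1), H2 p.1 p.2 • (u ^ (m + 2 * p.1 + p.2) * g p.1) := by
      rw [← sum_add_distrib]
      refine sum_congr rfl fun p hp => ?_
      rw [hH _ _ (HasAntidiagonal.mem_antidiagonal.mp hp), add_smul]
    rw [hR, Finset.Nat.sum_antidiagonal_succ', Finset.Nat.sum_antidiagonal_succ]
    simp only [H1_zero, H1_succ, H2_zero, H2_succ, zero_smul, zero_add, add_zero]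
    rw [← sum_add_distrib]
    refine sum_congr rfl fun p _ => ?_
    rw [Derivation.map_smul, hstep, smul_add, smul_smul]

/-- The relation between the coefficients of an equivariant map. -/
def Compatible (m : ℕ) (α : ℕ → ℂ) (k r : ℕ) : Prop :=
  α (k + r) * ((((k + r).choose k : ℕ) : ℂ) * (∏ l ∈ range r, ((m : ℂ) + k + l)) * (-1) ^ r)
    = α k * confCoeff (m + 2 * k : ℕ) r

theorem choose_add_succ (k r : ℕ) :
    (((k + (r + 1)).choose k : ℕ) : ℂ) * (r + 1) = (((k + r).choose k : ℕ) : ℂ) * (k + r + 1) := by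
  have := Nat.choose_mul_succ_eq (k + r) k
  rw [show k + r + 1 - k = r + 1 by omega] at this
  exact_mod_cast this.symm

theorem liftCoeff_zero (m : ℕ) : liftCoeff m 0 = 1 := by simp [liftCoeff]

theorem liftCoeff_succ (m n : ℕ) : liftCoeff m (n + 1) = liftCoeff m n *
    (-((m + 2 * n : ℂ) * (m + 2 * n + 2)) / (4 * (n + 1) * (m + n))) := by
  rw [liftCoeff, liftCoeff, prod_range_succ, Nat.factorial_succ, pow_succ, pow_succ]
  push_cast
  simp only [div_eq_mul_inv, mul_inv]
  ring

/-- Induction on r: with n = k + r, the factors n + 1 and m + n in the denominator of α(n+1)/α(n)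
cancel against the growth of the binomial and of the rising factorial, leaving the factor of κ(m+2k,
r+1)/κ(m+2k, r). -/
theorem compatible_liftCoeff {m : ℕ} (hm : 0 < m) (k r : ℕ) : Compatible m (liftCoeff m) k r := by
  induction r with
  | zero => simp [Compatible, confCoeff_zero_right]
  | succ r ih =>
    unfold Compatible at ih ⊢
    have h1 : (m : ℂ) + (k + r) ≠ 0 := by
      exact_mod_cast (by omega : m + (k + r) ≠ 0)
    have h2 : (k : ℂ) + r + 1 ≠ 0 := by exact_mod_cast Nat.succ_ne_zero (k + r)
    have h3 : (r : ℂ) + 1 ≠ 0 := by exact_mod_cast Nat.succ_ne_zero r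
    have e := choose_add_succ k r
    rw [confCoeff_succ, ← mul_assoc (liftCoeff m k), ← ih, ← add_assoc k r 1, liftCoeff_succ, prod_range_succ, pow_succ]
    rw [← add_assoc k r 1] at e
    rw [eq_div_of_mul_eq h3 e]
    push_cast
    field_simp
    ring

theorem compatible_liftCoeffZero (c : ℂ) (k r : ℕ) : Compatible 0 (liftCoeffZero c) k r := by
  -- At m = 0 the binomial times the rising factorial equals κ(2k, r), so for k > 0 the relation
  -- reads (-1)ʳ α(k+r) = α(k).
  have h : ∀ r, (((k + r).choose k : ℕ) : ℂ) * ∏ l ∈ range r, ((k : ℂ) + l)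
      = confCoeff (2 * k) r := by
    intro r
    induction r with
    | zero => simp [confCoeff_zero_right]
    | succ r ih =>
      have h3 : (r : ℂ) + 1 ≠ 0 := by exact_mod_cast Nat.succ_ne_zero r
      rw [confCoeff_succ, ← ih, prod_range_succ, eq_div_of_mul_eq h3 (choose_add_succ k r)]
      field_simp
      ring
  unfold Compatible
  -- For k = 0 and r > 0 both sides contain a zero factor, so α(0) imposes nothing on the later
  -- coefficients and c is free.
  rcases k with _ | k
  · rcases r with _ | r
    · simp [confCoeff_zero_right]
    · simp [confCoeff_zero_left, prod_range_succ']
  · have h' := h r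
    simp only [liftCoeffZero, if_neg (show k + 1 + r ≠ 0 by omega), if_neg (Nat.succ_ne_zero k)]
    push_cast at h' ⊢
    simp only [zero_add]
    rw [← h', pow_add (-1 : ℂ) (k + 1) r]
    have : ((-1 : ℂ) ^ r) * (-1) ^ r = 1 := by rw [← mul_pow]; simp
    linear_combination (c * (-1) ^ (k + 1) * (((k + 1 + r).choose (k + 1) : ℕ) : ℂ)
      * ∏ l ∈ range r, ((k : ℂ) + 1 + l)) * this

/-! ### The action of Γ on R and on C₀, and the criterion for equivariance -/

namespace FunctionAlgebra

variable {Γ : Subgroup SL2C} (S : FunctionAlgebra Γ)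

/-- The function `(c z + d)⁻¹` of `R`. -/
def invAut (γ : Γ) : S.R := ((S.s γ)⁻¹ : (S.R)ˣ)

theorem s_mul_invAut (γ : Γ) : (S.s γ : S.R) * S.invAut γ = 1 := (S.s γ).mul_inv

theorem slash_eq (m : ℕ) (γ : Γ) (f : S.R) : S.slash m γ f = S.invAut γ ^ m * S.act γ f := by
  rw [slash, zpow_neg, zpow_natCast, ← inv_pow, Units.val_pow_eq_pow_val, invAut]

theorem act_smul (γ : Γ) (c : ℂ) (f : S.R) : S.act γ (c • f) = c • S.act γ f := by
  apply Subtype.ext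
  obtain ⟨f, hf⟩ := f
  induction f using Quotient.inductionOn'
  rfl

theorem act_zero (γ : Γ) : S.act γ 0 = 0 := rfl

theorem act_one (γ : Γ) : S.act γ 1 = 1 := rfl

theorem partialZ_s (γ : Γ) : S.partialZ (S.s γ : S.R) = algebraMap ℂ S.R (γ.1.1 1 0) := by
  apply Subtype.ext
  change FunGerm.deriv ((S.s γ : S.R) : FunGerm S.U) = _
  rw [s_spec, FunGerm.deriv_of]
  change _ = FunGerm.of S.U fun _ => γ.1.1 1 0
  congr 1
  funext z
  have h : HasDerivAt (fun z => γ.1.1 1 0 * z + γ.1.1 1 1) (γ.1.1 1 0) z := by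
    simpa using ((hasDerivAt_id z).const_mul (γ.1.1 1 0)).add_const (γ.1.1 1 1)
  exact h.deriv

theorem partialZ_invAut (γ : Γ) :
    S.partialZ (S.invAut γ) = (-γ.1.1 1 0) • S.invAut γ ^ 2 := by
  have h := congrArg S.partialZ (S.s_mul_invAut γ)
  rw [Derivation.leibniz, partialZ_s, Derivation.map_one_eq_zero, smul_eq_mul, smul_eq_mul] at h
  have h1 := S.s_mul_invAut γ
  rw [Algebra.smul_def, map_neg]
  linear_combination (-S.partialZ (S.invAut γ)) * h1 + S.invAut γ * h

theorem deltaZ_invAut (γ : Γ) :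
    S.deltaZ (S.invAut γ) = (γ.1.1 1 0 / 2) • S.invAut γ ^ 2 := by
  change (-(1 / 2) : ℂ) • S.partialZ (S.invAut γ) = _
  rw [partialZ_invAut, smul_smul]
  congr 1; ring

theorem hasDerivAt_moebius (γ : SL2C) {z : ℂ} (hz : autFactor γ z ≠ 0) :
    HasDerivAt (moebius γ) (1 / autFactor γ z ^ 2) z := by
  have hdet : γ.1 0 0 * γ.1 1 1 - γ.1 0 1 * γ.1 1 0 = 1 := by
    rw [← Matrix.det_fin_two]; exact γ.2
  have h1 : HasDerivAt (fun z => γ.1 0 0 * z + γ.1 0 1) (γ.1 0 0) z := by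
    simpa using ((hasDerivAt_id z).const_mul (γ.1 0 0)).add_const (γ.1 0 1)
  have h2 : HasDerivAt (autFactor γ) (γ.1 1 0) z := by
    change HasDerivAt (fun z => γ.1 1 0 * z + γ.1 1 1) (γ.1 1 0) z
    simpa using ((hasDerivAt_id z).const_mul (γ.1 1 0)).add_const (γ.1 1 1)
  have h3 := h1.div h2 hz
  have e : (γ.1 0 0 * autFactor γ z - (γ.1 0 0 * z + γ.1 0 1) * γ.1 1 0) = 1 := by
    unfold autFactor; linear_combination hdet
  rw [e] at h3
  exact h3

/-- As c z + d is a unit of R, it has an inverse on a dense open set, and so no zero there. -/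
theorem eventually_autFactor_ne_zero (γ : Γ) :
    ∀ᶠ z in denseOpens S.U, autFactor γ.1 z ≠ 0 := by
  have h := congrArg (Subtype.val : S.R → FunGerm S.U) (S.s_mul_invAut γ)
  change ((S.s γ : S.R) : FunGerm S.U) * _ = FunGerm.of S.U (fun _ => 1) at h
  rw [s_spec] at h
  obtain ⟨v, hv⟩ := Quotient.exists_rep ((S.invAut γ : S.R) : FunGerm S.U)
  rw [← hv] at h
  have h' : ∀ᶠ z in denseOpens S.U, autFactor γ.1 z * v z = 1 := Germ.coe_eq.mp h
  filter_upwards [h'] with z hz h0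
  rw [h0, zero_mul] at hz
  exact zero_ne_one hz

/-- Chain rule, the derivative of the homography being (c z + d)⁻² because the determinant is 1. -/
theorem partialZ_act (γ : Γ) (f : S.R) :
    S.partialZ (S.act γ f) = S.invAut γ ^ 2 * S.act γ (S.partialZ f) := by
  -- Multiplied by (c z + d)², the identity involves only germs with an explicit representative.
  have key : (S.s γ : S.R) ^ 2 * S.partialZ (S.act γ f) = S.act γ (S.partialZ f) := by
    apply Subtype.ext
    change ((S.s γ : S.R) : FunGerm S.U) ^ 2 * _ = _
    rw [s_spec]
    obtain ⟨f, hf⟩ := f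
    obtain ⟨f, rfl, df⟩ := S.isHolomorphic f hf
    change FunGerm.of S.U (fun z => autFactor γ.1 z ^ 2 * deriv (f ∘ moebius γ.1) z)
      = FunGerm.of S.U (deriv f ∘ moebius γ.1)
    refine FunGerm.of_eq_of ?_
    filter_upwards [S.eventually_autFactor_ne_zero γ,
      (tendsto_moebius γ.1 (S.moebius_mem γ γ.2)).eventually df] with z hz hd
    rw [(hd.hasDerivAt.comp z (hasDerivAt_moebius γ.1 hz)).deriv]
    simp only [Function.comp]
    field_simp
  rw [← key, ← mul_assoc, ← mul_pow, mul_comm (S.invAut γ), s_mul_invAut, one_pow, one_mul]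

theorem invAut_ne_zero (γ : Γ) : S.invAut γ ≠ 0 := by
  have := S.isDomain
  exact (S.s γ)⁻¹.ne_zero

/-- Y₁ starts with u y and has square y² u², so it is the unique square root that defines y·γ. -/
theorem yAct_pow (γ : Γ) (n : ℕ) :
    S.yAct γ ^ n = confSeries S.deltaZ (γ.1.1 1 0) (S.invAut γ) n := by
  have := S.isDomain
  have hu := S.deltaZ_invAut γ
  rw [← confSeries_one_pow hu (S.invAut_ne_zero γ)]
  congr 1
  refine (S.existsUnique_yAct γ).unique (S.existsUnique_yAct γ).choose_spec.1 ⟨?_, ?_, ?_⟩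
  · exact coeff_stepSeries_eq_zero _ fun r => by omega
  · rw [show coeff 1 (confSeries S.deltaZ (γ.1.1 1 0) (S.invAut γ) 1) = _ from
      coeff_stepSeries 1 0 _]
    simp [confCoeff_zero_right, invAut]
  · rw [confSeries_one_pow hu (S.invAut_ne_zero γ), confSeries_two hu, xAct, y, zpow_neg,
      ← inv_zpow]
    rfl

theorem diffSeries_apply (m : ℕ) (α : ℕ → ℂ) (f : S.R) :
    S.diffSeries m α f = stepSeries m fun r => α r • (S.partialZ^[r]) f := rfl

/-- The power (y·γ)^(m+2k) only involves exponents m + 2k + 2r, so degree m + 2n collects exactly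
the pairs with k + r = n. -/
theorem actC_stepSeries (γ : Γ) (m : ℕ) (a : ℕ → S.R) :
    S.actC γ (stepSeries m a) = stepSeries m fun n => ∑ p ∈ antidiagonal n,
      (confCoeff (m + 2 * p.1 : ℕ) p.2 * γ.1.1 1 0 ^ p.2) •
        (S.invAut γ ^ (m + 2 * p.1 + p.2) * S.act γ (a p.1)) := by
  refine eq_stepSeries_iff.mpr ⟨fun n => ?_, fun n hn => ?_⟩
  · rw [actC, coeff_mk, sum_range_step (i := m) (r := n) (by omega),
      Finset.Nat.sum_antidiagonal_eq_sum_range_succ_mk]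
    · refine sum_congr rfl fun k hk => ?_
      rw [mem_range] at hk
      rw [coeff_stepSeries, yAct_pow, confSeries, show m + 2 * n = m + 2 * k + 2 * (n - k) by omega,
        coeff_stepSeries, mul_smul_comm, mul_comm (S.act γ (a k))]
    · intro j hj
      by_cases h : ∀ k, j ≠ m + 2 * k
      · rw [coeff_stepSeries_eq_zero a h, act_zero, zero_mul]
      · push Not at h
        obtain ⟨k, rfl⟩ := h
        rw [yAct_pow, confSeries, coeff_stepSeries_eq_zero (i := m + 2 * k), mul_zero]
        intro r hr
        exact hj k (by omega) rfl
  · rw [actC, coeff_mk]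
    refine sum_eq_zero fun j _ => ?_
    by_cases h : ∀ k, j ≠ m + 2 * k
    · rw [coeff_stepSeries_eq_zero a h, act_zero, zero_mul]
    · push Not at h
      obtain ⟨k, rfl⟩ := h
      rw [yAct_pow, confSeries, coeff_stepSeries_eq_zero (i := m + 2 * k), mul_zero]
      intro r hr
      exact hn (k + r) (by omega)

/-- Bol's formula for gₖ = f⁽ᵏ⁾·γ, whose hypothesis gₖ' = u² gₖ₊₁ is the chain rule. -/
theorem iterate_partialZ_slash (m n : ℕ) (γ : Γ) (f : S.R) :
    (S.partialZ^[n]) (S.slash m γ f) = ∑ p ∈ antidiagonal n,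
      ((((p.1 + p.2).choose p.1 : ℕ) : ℂ) * (∏ l ∈ range p.2, ((m : ℂ) + p.1 + l)) *
        (-γ.1.1 1 0) ^ p.2) •
        (S.invAut γ ^ (m + 2 * p.1 + p.2) * S.act γ ((S.partialZ^[p.1]) f)) := by
  rw [slash_eq]
  exact iterate_pow_mul S.partialZ (S.partialZ_invAut γ)
    (g := fun k => S.act γ ((S.partialZ^[k]) f))
    (fun k => by rw [partialZ_act, Function.iterate_succ_apply']) m n

/-- The defect of equivariance of `diffSeries m α` in degree `m + 2 n`. -/
theorem isEquivariant_diffSeries_iff (m : ℕ) (α : ℕ → ℂ) :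
    S.IsEquivariant m (S.diffSeries m α) ↔ ∀ (γ : Γ) (f : S.R) (n : ℕ), ∑ p ∈ antidiagonal n,
      ((α (p.1 + p.2) * ((((p.1 + p.2).choose p.1 : ℕ) : ℂ) *
        (∏ l ∈ range p.2, ((m : ℂ) + p.1 + l)) * (-1) ^ p.2)
          - α p.1 * confCoeff (m + 2 * p.1 : ℕ) p.2) * γ.1.1 1 0 ^ p.2) •
        (S.invAut γ ^ (m + 2 * p.1 + p.2) * S.act γ ((S.partialZ^[p.1]) f)) = 0 := by
  refine forall_congr' fun γ => forall_congr' fun f => ?_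
  have h : ∀ a b : ℕ → S.R, (stepSeries m a : S.C₀) = stepSeries m b ↔ ∀ n, a n - b n = 0 := by
    intro a b
    refine ⟨fun h n => ?_, fun h => ?_⟩
    · have := congrArg (coeff (m + 2 * n)) h
      rwa [coeff_stepSeries, coeff_stepSeries, ← sub_eq_zero] at this
    · congr 1
      exact funext fun n => sub_eq_zero.mp (h n)
  rw [diffSeries_apply, diffSeries_apply, actC_stepSeries, h]
  refine forall_congr' fun n => ?_
  rw [iterate_partialZ_slash, smul_sum, ← sum_sub_distrib]
  refine Eq.congr_left (sum_congr rfl fun p hp => ?_)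
  -- Replacing n by k + r and taking the sign out of (-c)ʳ lets both terms share the factor cʳ.
  rw [act_smul, mul_smul_comm, smul_smul, smul_smul, ← sub_smul, ← HasAntidiagonal.mem_antidiagonal.mp hp,
    neg_pow (γ.1.1 1 0)]
  congr 1
  ring

theorem isEquivariant_of_compatible {m : ℕ} {α : ℕ → ℂ} (h : ∀ k r, Compatible m α k r) :
    S.IsEquivariant m (S.diffSeries m α) := by
  rw [isEquivariant_diffSeries_iff]
  intro γ f n
  refine sum_eq_zero fun p _ => ?_
  rw [sub_eq_zero.mpr (h p.1 p.2), zero_mul, zero_smul]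

variable {S}

/-- Test on f = 1: its derivatives vanish, so only k = 0 remains, and cⁿ u^(m+n) is nonzero. -/
theorem IsEquivariant.compatible_zero {m : ℕ} {α : ℕ → ℂ}
    (h : S.IsEquivariant m (S.diffSeries m α)) {γ : Γ} (hγ : γ.1.1 1 0 ≠ 0) (n : ℕ) :
    Compatible m α 0 n := by
  have := S.isDomain
  have h1 := (S.isEquivariant_diffSeries_iff m α).mp h γ 1 n
  rw [sum_eq_single (0, n)] at h1
  · simp only [Function.iterate_zero, id, act_one, mul_one] at h1
    rcases smul_eq_zero.mp h1 with h2 | h2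
    · rcases mul_eq_zero.mp h2 with h3 | h3
      · exact sub_eq_zero.mp h3
      · exact absurd h3 (pow_ne_zero _ hγ)
    · exact absurd h2 (pow_ne_zero _ (S.invAut_ne_zero γ))
  · rintro ⟨k, r⟩ hp hk
    rw [HasAntidiagonal.mem_antidiagonal] at hp
    rcases k with _ | k
    · exact absurd (by simpa using hp) hk
    · simp only [QuadSeries.iterate_map_one, act_zero, mul_zero, smul_zero]
  · intro h; exact absurd (by simp) h

/-- Test on f = c z + d, an element of R with f' = c ≠ 0 and f'' = 0: the term k = 0 is already
known to vanish, so the term k = 1 vanishes too. -/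
theorem IsEquivariant.compatible_one {m : ℕ} {α : ℕ → ℂ}
    (h : S.IsEquivariant m (S.diffSeries m α)) {γ : Γ} (hγ : γ.1.1 1 0 ≠ 0) (n : ℕ) :
    Compatible m α 1 n := by
  have := S.isDomain
  have h1 := (S.isEquivariant_diffSeries_iff m α).mp h γ (S.s γ) (n + 1)
  rw [sum_eq_single (1, n)] at h1
  · simp only [Function.iterate_one, partialZ_s, Algebra.algebraMap_eq_smul_one, act_smul,
      act_one, mul_smul_comm, mul_one] at h1
    rcases smul_eq_zero.mp h1 with h2 | h2
    · rcases mul_eq_zero.mp h2 with h3 | h3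
      · exact sub_eq_zero.mp h3
      · exact absurd h3 (pow_ne_zero _ hγ)
    · exact absurd h2 (smul_ne_zero hγ (pow_ne_zero _ (S.invAut_ne_zero γ)))
  · rintro ⟨k, r⟩ hp hk
    rw [HasAntidiagonal.mem_antidiagonal] at hp
    rcases k with _ | _ | k
    · have := sub_eq_zero.mpr (h.compatible_zero hγ r)
      rw [this, zero_mul, zero_smul]
    · exact absurd (by simp; omega) hk
    · simp only [Function.iterate_succ_apply, partialZ_s, Derivation.map_algebraMap,
        QuadSeries.iterate_map_zero, act_zero, mul_zero, smul_zero]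
  · intro h; exact absurd (by simp [add_comm]) h

/-- Both sequences satisfy the relation with k = 0 and start at 1; the factor of α(n) is nonzero
since m > 0. -/
theorem IsEquivariant.eq_liftCoeff {m : ℕ} (hm : 0 < m) {α : ℕ → ℂ}
    (h : S.IsEquivariant m (S.diffSeries m α)) (h0 : α 0 = 1) {γ : Γ} (hγ : γ.1.1 1 0 ≠ 0) :
    α = liftCoeff m := by
  funext n
  have h1 := h.compatible_zero hγ n
  have h2 := compatible_liftCoeff hm 0 n
  unfold Compatible at h1 h2
  rw [h0] at h1
  rw [liftCoeff_zero] at h2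
  have h3 := h1.trans h2.symm
  rw [zero_add] at h3
  refine mul_right_cancel₀ (mul_ne_zero (mul_ne_zero ?_ (prod_ne_zero_iff.mpr fun l _ => ?_)) ?_) h3
  · simp
  · rw [Nat.cast_zero, add_zero]
    exact_mod_cast (by omega : m + l ≠ 0)
  · exact pow_ne_zero _ (by simp)

/-- The relation with k = 1 has a nonzero factor in front of α(n+1), hence α(1) determines the rest;
the parameter is -α(1) because `liftCoeffZero c 1` is -c. -/
theorem IsEquivariant.eq_liftCoeffZero {α : ℕ → ℂ}
    (h : S.IsEquivariant 0 (S.diffSeries 0 α)) (h0 : α 0 = 1) {γ : Γ} (hγ : γ.1.1 1 0 ≠ 0) :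
    α = liftCoeffZero (-α 1) := by
  funext n
  rcases n with _ | n
  · simp [liftCoeffZero, h0]
  · have h1 := h.compatible_one hγ n
    have h2 := compatible_liftCoeffZero (-α 1) 1 n
    unfold Compatible at h1 h2
    rw [show liftCoeffZero (-α 1) 1 = α 1 by simp [liftCoeffZero]] at h2
    have h3 := h1.trans h2.symm
    rw [add_comm 1 n] at h3
    refine mul_right_cancel₀ (mul_ne_zero (mul_ne_zero ?_ (prod_ne_zero_iff.mpr fun l _ => ?_)) ?_) h3
    · exact_mod_cast (Nat.choose_pos (by omega)).ne'
    · exact_mod_cast (by omega : 0 + 1 + l ≠ 0)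
    · exact pow_ne_zero _ (by simp)

end FunctionAlgebra

/-! ### Closed forms of the coefficients -/

theorem liftCoeff_even {k : ℕ} (hk : 0 < k) (n : ℕ) : liftCoeff (2 * k) n =
    (((2 * k - 1).factorial : ℂ) * ((n + k - 1).factorial : ℂ)) /
      (((n + 2 * k - 1).factorial : ℂ) * ((k - 1).factorial : ℂ)) *
      ((Ring.choose (-(k : ℤ) - 1) n : ℤ) : ℂ) := by
  -- The upper negation rule turns the generalised binomial into a natural one, which has a simple
  -- ratio in n.
  have hchoose : ((Ring.choose (-(k : ℤ) - 1) n : ℤ) : ℂ)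
      = (-1) ^ n * (((k + n).choose k : ℕ) : ℂ) := by
    have : -(k : ℤ) - 1 = -((k + 1 : ℕ) : ℤ) := by push_cast; ring
    rw [this, Ring.choose_neg, Nat.cast_add, Nat.cast_one, add_right_comm, add_sub_cancel_right,
      ← Nat.cast_add, Ring.choose_natCast, Nat.choose_symm_add]
    simp [Int.negOnePow_def, Units.smul_def]
  rw [hchoose]
  clear hchoose
  -- Writing k + 1 for k makes every truncated subtraction in the factorials exact.
  obtain ⟨k, rfl⟩ := Nat.exists_eq_add_of_lt hk
  simp only [zero_add]
  have hf : ∀ n : ℕ, ((n.factorial : ℕ) : ℂ) ≠ 0 := fun n => by exact_mod_cast n.factorial_ne_zero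
  induction n with
  | zero =>
    rw [liftCoeff_zero]
    have h1 := hf (2 * (k + 1) - 1)
    have h2 := hf k
    simp
    field_simp
  | succ n ih =>
    have h3 : (n : ℂ) + 1 ≠ 0 := by exact_mod_cast Nat.succ_ne_zero n
    have e := choose_add_succ (k + 1) n
    rw [liftCoeff_succ, ih, eq_div_of_mul_eq h3 e, show n + 1 + (k + 1) - 1 = n + k + 1 by omega,
      show n + 1 + 2 * (k + 1) - 1 = n + 2 * k + 1 + 1 by omega, show n + (k + 1) - 1 = n + k by omega,
      show n + 2 * (k + 1) - 1 = n + 2 * k + 1 by omega, Nat.factorial_succ (n + k),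
      Nat.factorial_succ (n + 2 * k + 1), pow_succ]
    have h1 := hf (n + 2 * k + 1)
    have h2 := hf (k + 1 - 1)
    have h4 : (n : ℂ) + 2 * k + 1 + 1 ≠ 0 := by exact_mod_cast Nat.succ_ne_zero (n + 2 * k + 1)
    have h5 : 2 * ((k : ℂ) + 1) + n ≠ 0 := by convert h4 using 1; ring
    push_cast
    field_simp
    ring

/-- Induction on n by ratios: the four new factors in the numerator include (2k+2n+2)², which
cancels (k+n+1)² and turns 16 into 4. -/
theorem liftCoeff_odd (k n : ℕ) : liftCoeff (2 * k + 1) n =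
    (k.factorial : ℂ) ^ 2 / ((2 * k + 1).factorial : ℂ) * ((-1) ^ n / 16 ^ n) *
      ((((2 * k + 1 + 2 * n).factorial : ℂ) * ((2 * k + 2 * n).factorial : ℂ)) /
        ((n.factorial : ℂ) * ((2 * k + n).factorial : ℂ) * ((k + n).factorial : ℂ) ^ 2)) := by
  have hf : ∀ n : ℕ, ((n.factorial : ℕ) : ℂ) ≠ 0 := fun n => by exact_mod_cast n.factorial_ne_zero
  induction n with
  | zero =>
    rw [liftCoeff_zero]
    have h1 := hf (2 * k + 1)
    have h2 := hf (2 * k)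
    have h3 := hf k
    simp
    field_simp
  | succ n ih =>
    have h1 := hf (2 * k + 1)
    have h2 := hf n
    have h3 := hf (2 * k + n)
    have h4 := hf (k + n)
    have h5 : (n : ℂ) + 1 ≠ 0 := by exact_mod_cast Nat.succ_ne_zero n
    have h6 : 2 * (k : ℂ) + n + 1 ≠ 0 := by exact_mod_cast Nat.succ_ne_zero (2 * k + n)
    have h7 : (k : ℂ) + n + 1 ≠ 0 := by exact_mod_cast Nat.succ_ne_zero (k + n)
    have h8 : 2 * (k : ℂ) + 1 + n ≠ 0 := by convert h6 using 1; ring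
    rw [liftCoeff_succ, ih, show 2 * k + 1 + 2 * (n + 1) = 2 * k + 1 + 2 * n + 1 + 1 by omega,
      show 2 * k + 2 * (n + 1) = 2 * k + 2 * n + 1 + 1 by omega, ← add_assoc, ← add_assoc,
      Nat.factorial_succ (2 * k + 1 + 2 * n + 1), Nat.factorial_succ (2 * k + 1 + 2 * n),
      Nat.factorial_succ (2 * k + 2 * n + 1), Nat.factorial_succ (2 * k + 2 * n),
      Nat.factorial_succ n, Nat.factorial_succ (2 * k + n), Nat.factorial_succ (k + n), pow_succ,
      pow_succ]
    push_cast
    field_simp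
    ring

end Homographic

end


/-! ### The theorem -/

theorem mainTheorem6 {Γ : Subgroup Homographic.SL2C} (S : Homographic.FunctionAlgebra Γ) :
    -- existence for `m > 0`, with the explicit coefficients
    (∀ m : ℕ, 0 < m → S.IsLift m (S.diffSeries m (Homographic.liftCoeff m))) ∧
    -- uniqueness for `m > 0`, of the map and of its coefficients
    ((∃ γ ∈ Γ, γ.1 1 0 ≠ 0) → ∀ m : ℕ, 0 < m →
      (∀ ψ : S.R →ₗ[ℂ] S.C₀, S.IsLift m ψ → ψ = S.diffSeries m (Homographic.liftCoeff m)) ∧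
      (∀ α : ℕ → ℂ, S.IsEquivariant m (S.diffSeries m α) → α 0 = 1 →
        α = Homographic.liftCoeff m)) ∧
    -- the closed form for even `m = 2 k > 0`
    (∀ k n : ℕ, 0 < k → Homographic.liftCoeff (2 * k) n =
      (((2 * k - 1).factorial : ℂ) * ((n + k - 1).factorial : ℂ)) /
        (((n + 2 * k - 1).factorial : ℂ) * ((k - 1).factorial : ℂ)) *
        ((Ring.choose (-(k : ℤ) - 1) n : ℤ) : ℂ)) ∧
    -- the closed form for odd `m = 2 k + 1`
    (∀ k n : ℕ, Homographic.liftCoeff (2 * k + 1) n =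
      (k.factorial : ℂ) ^ 2 / ((2 * k + 1).factorial : ℂ) * ((-1) ^ n / 16 ^ n) *
        ((((2 * k + 1 + 2 * n).factorial : ℂ) * ((2 * k + 2 * n).factorial : ℂ)) /
          ((n.factorial : ℂ) * ((2 * k + n).factorial : ℂ) * ((k + n).factorial : ℂ) ^ 2))) ∧
    -- the case `m = 0`
    (∀ c : ℂ, S.IsLift 0 (S.diffSeries 0 (Homographic.liftCoeffZero c))) ∧
    ((∃ γ ∈ Γ, γ.1 1 0 ≠ 0) → ∀ ψ : S.R →ₗ[ℂ] S.C₀, S.IsLift 0 ψ →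
      ∃ c : ℂ, ψ = S.diffSeries 0 (Homographic.liftCoeffZero c)) := by
  refine ⟨fun m hm => ⟨?_, Homographic.liftCoeff m, rfl, Homographic.liftCoeff_zero m⟩, ?_,
    fun k n hk => Homographic.liftCoeff_even hk n, Homographic.liftCoeff_odd, fun c => ⟨?_,
    Homographic.liftCoeffZero c, rfl, if_pos rfl⟩, ?_⟩
  · exact S.isEquivariant_of_compatible (Homographic.compatible_liftCoeff hm)
  · rintro ⟨γ, hγ, hc⟩ m hm
    refine ⟨?_, fun α hα h0 => hα.eq_liftCoeff hm h0 (γ := ⟨γ, hγ⟩) hc⟩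
    rintro _ ⟨hα, α, rfl, h0⟩
    rw [hα.eq_liftCoeff hm h0 (γ := ⟨γ, hγ⟩) hc]
  · exact S.isEquivariant_of_compatible (Homographic.compatible_liftCoeffZero c)
  · rintro ⟨γ, hγ, hc⟩ _ ⟨hα, α, rfl, h0⟩
    exact ⟨-α 1, congrArg _ (hα.eq_liftCoeffZero h0 (γ := ⟨γ, hγ⟩) hc)⟩
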